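/- **Setting.** Let $\{X_t\}$ be a $\phi$-irreducible ($\phi\neq 0$), aperiodic, Harris recurrent Markov chain with transition probability $P$ on a measurable space $(E,\mathcal E)$, and let $\mathcal E^+$ be the class of nonnegative measurable real functions $\eta$ with $\phi\{\eta>0\}>0$. A function $\eta\in\mathcal E^+$ is *small* if $P^m(x,A)\ge b\,\eta(x)\lambda(A)$ for all $x,A$, for some nonzero measure $\lambda$, some $b>0$ and some integer $m\ge 1$. Assume that $P(x,A)\ge s(x)\nu(A)$ for all $x,A$, where $s\in\mathcal E^+$ and $\nu$ is a probability measure. Put $$G_{s,\nu}=\sum_{\ell=0}^\infty (P-s\otimes\nu)^\ell,\qquad \pi_s=\nu G_{s,\nu},\qquad \mu_g=\pi_s g=\int g\,d\pi_s ,\qquad g_0=g-s\mu_g .$$ Let $\{(X_t,Y_t)\}$ be the split chain: given $X_t=x$ and the past, $Y_t\in\{0,1\}$ equals $1$ with probability $s(x)$; given $(X_t,Y_t)=(x,1)$, $X_{t+1}$ has law $\nu$; given $(X_t,Y_t)=(x,0)$, $X_{t+1}$ has law $Q(x,\cdot)=(P(x,\cdot)-s(x)\nu)/(1-s(x))$ (and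 $Q(x,\cdot)=\delta_x$ if $s(x)=1$). Let $\tau=\min\{t\ge0: Y_t=1\}$ and $U_0(g)=\sum_{t=0}^{\tau} g(X_t)$. The block variance is $\sigma^2(g)=\operatorname{Var}_\nu(U_0(g))$, the variance when $X_0\sim\nu$. For $g,f\in L^1(\pi_s)\cap L^2(\pi_s)$ the generalized cross-covariance function is $$\gamma_{g,f}(\ell)=\begin{cases}\pi_s(g_0f_0)+\mu_g\mu_f(1-\pi_s s^2),&\ell=0,\\ \varphi_g P^{\ell-1}f_0,&\ell\ge1,\\ \gamma_{f,g}(-\ell),&\ell<0,\end{cases}\qquad \varphi_g(h)=\int g\,(Ph)\,d\pi_s-\mu_g\,\nu h,$$ and $\gamma_g=\gamma_{g,g}$. A series $\sum_{\ell=-\infty}^\infty a_\ell=S$ means that $\sum_{\ell=-m}^{n}a_\ell\to S$ as $m,n\to\infty$ independently (convergence may be conditional). All functions below are real-valued and measurable. **Lemma 3.6.** If $|g|$ is small, then $g\in L^1(\pi_s)\cap L^2(\pi_s)$, $U_0(g)$ has a finite second moment under $\mathbb P_\nu$, and $$\sigma^2(g)=\sum_{\ell=-\infty}^{\infty}\gamma_g(\ell).$$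 **Lemma 3.7.** Let $g$ satisfy (i) $g\in L^1(\pi_s)\cap L^2(\pi_s)$ and $\int |g|\,(P\,G_{s,\nu}|g|)\,d\pi_s<\infty$, and let $\{g_n\}$ be such that each $|g_n|$ is a small function, $|g_n|\le|g|$ $\pi_s$-a.e. for every $n$, and $g_n\to g$ $\pi_s$-a.e. Then (ii) $\gamma_{g_n}(\ell)\to\gamma_g(\ell)$ as $n\to\infty$, for each $\ell\in\mathbb Z$; (iii) $U_0(g)$ has a finite second moment under $\mathbb P_\nu$, and $\sigma^2(g)=\lim_n\sum_{\ell=-\infty}^\infty\gamma_{g_n}(\ell)$, where each of the series converges. Suppose moreover that (iv) $\gamma_{g_n}(\ell)=\eta_n b_\ell+d_{n,\ell}$ for all $n$ and all $\ell\ge1$, where $\eta_n,b_\ell,d_{n,\ell}$ are real numbers with $\sum_{\ell=1}^\infty\sup_n|d_{n,\ell}|<\infty$, $\eta_n\to\eta\in\mathbb R$ as $n\to\infty$, and the series $\sum_{\ell=1}^\infty b_\ell$ converges (possibly only conditionally). Then (v) $\sigma^2(g)=\sum_{\ell=-\infty}^\infty\gamma_g(\ell)$, and if $\eta=0$, the convergence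 is absolute. -/

import Mathlib

open MeasureTheory ProbabilityTheory Filter Topology
open scoped ENNReal

noncomputable section

/-- The law, on the space of paths `ℕ → S`, of the time-homogeneous Markov chain with transition
probability `K` and initial distribution `lam`. -/
def chainLaw {S : Type*} [MeasurableSpace S] (K : Kernel S S) [IsMarkovKernel K]
    (lam : Measure S) : Measure (ℕ → S) :=
  Kernel.trajMeasure (X := fun _ : ℕ => S) lam
    (fun n : ℕ => K.comap
      (fun h : ((i : Finset.Iic n) → (fun _ : ℕ => S) (i : ℕ)) =>
        h ⟨n, Finset.mem_Iic.mpr le_rfl⟩) (measurable_pi_apply _))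

/-- The class `𝓔⁺`: nonnegative measurable functions with `φ`-positive support. -/
structure IsPosFun {E : Type*} [MeasurableSpace E] (φ : Measure E) (η : E → ℝ) : Prop where
  measurable : Measurable η
  nonneg : ∀ x, 0 ≤ η x
  pos : 0 < φ {x | 0 < η x}

/-- `η ∈ 𝓔⁺` is small for `P` if `P ^ m ≥ b η ⊗ lam` for some (nontrivial) measure `lam`,
constant `b > 0` and integer `m ≥ 1`. -/
def IsSmall {E : Type*} [MeasurableSpace E] (φ : Measure E) (P : Kernel E E) (η : E → ℝ) : Prop :=
  IsPosFun φ η ∧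
    ∃ lam : Measure E, lam ≠ 0 ∧ ∃ b : ℝ, 0 < b ∧ ∃ m : ℕ, 1 ≤ m ∧
      ∀ x : E, ∀ A : Set E, MeasurableSet A → ENNReal.ofReal (b * η x) * lam A ≤ (P ^ m) x A

/-- Harris recurrence: from every starting point, almost every path visits every `φ`-positive set
infinitely often. -/
def IsHarrisRecurrent {E : Type*} [MeasurableSpace E] (φ : Measure E) (P : Kernel E E)
    [IsMarkovKernel P] : Prop :=
  ∀ A : Set E, MeasurableSet A → 0 < φ A → ∀ x : E,
    ∀ᵐ ω ∂(chainLaw P (Measure.dirac x)), ∃ᶠ n in atTop, ω n ∈ A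

/-- Aperiodicity: there is no cycle of length `d ≥ 2`, that is, no family of `d` disjoint nonempty
measurable sets `C 0, …, C (d - 1)` through which the chain moves cyclically. -/
def IsAperiodic {E : Type*} [MeasurableSpace E] (P : Kernel E E) : Prop :=
  ∀ d : ℕ, 2 ≤ d → ¬ ∃ C : ZMod d → Set E,
    (∀ i, MeasurableSet (C i)) ∧ (∀ i, (C i).Nonempty) ∧
    (∀ i j, i ≠ j → Disjoint (C i) (C j)) ∧
    ∀ i, ∀ x ∈ C i, P x (C (i + 1)) = 1

/-- A transition probability `P` on `E` together with an atom `(s, ν)`: a nonnegative measurable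
function `s` and a probability measure `ν` with `P ≥ s ⊗ ν`. -/
structure AtomicChain (E : Type*) [MeasurableSpace E] where
  P : Kernel E E
  s : E → ℝ
  ν : Measure E
  isMarkov : IsMarkovKernel P
  isProb : IsProbabilityMeasure ν
  measurable_s : Measurable s
  s_nonneg : ∀ x, 0 ≤ s x
  minorization : ∀ x : E, ∀ A : Set E, MeasurableSet A → ENNReal.ofReal (s x) * ν A ≤ P x A

attribute [instance] AtomicChain.isMarkov AtomicChain.isProb

/-- The two-sided series `∑_{ℓ = -∞}^{∞} a ℓ` converges (possibly only conditionally) to `S`: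
`∑_{ℓ = -m}^{n} a ℓ → S` as `m` and `n` tend to infinity independently. -/
def HasBilateralSum (a : ℤ → ℝ) (S : ℝ) : Prop :=
  Tendsto (fun p : ℕ × ℕ => ∑ ℓ ∈ Finset.Icc (-(p.1 : ℤ)) (p.2 : ℤ), a ℓ) atTop (𝓝 S)

namespace AtomicChain

variable {E : Type*} [MeasurableSpace E] (M : AtomicChain E)

theorem smul_nu_le (x : E) : ENNReal.ofReal (M.s x) • M.ν ≤ M.P x := by
  refine Measure.le_iff.mpr fun A hA => ?_
  simpa using M.minorization x A hA

theorem s_le_one (x : E) : M.s x ≤ 1 := by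
  have h := M.minorization x Set.univ MeasurableSet.univ
  simpa using h

/-- The taboo kernel `H = P - s ⊗ ν`. -/
def H : Kernel E E where
  toFun x := M.P x - ENNReal.ofReal (M.s x) • M.ν
  measurable' := by
    refine Measure.measurable_of_measurable_coe _ fun A hA => ?_
    have h : (fun x => (M.P x - ENNReal.ofReal (M.s x) • M.ν) A) =
        fun x => M.P x A - ENNReal.ofReal (M.s x) * M.ν A := by
      funext x
      have : IsFiniteMeasure (ENNReal.ofReal (M.s x) • M.ν) :=
        isFiniteMeasure_of_le _ (M.smul_nu_le x)
      rw [Measure.sub_apply hA (M.smul_nu_le x)]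
      simp
    rw [h]
    exact (Kernel.measurable_coe M.P hA).sub
      (M.measurable_s.ennreal_ofReal.mul_const _)

theorem H_apply (x : E) {A : Set E} (hA : MeasurableSet A) :
    M.H x A = M.P x A - ENNReal.ofReal (M.s x) * M.ν A := by
  have : IsFiniteMeasure (ENNReal.ofReal (M.s x) • M.ν) :=
    isFiniteMeasure_of_le _ (M.smul_nu_le x)
  change (M.P x - ENNReal.ofReal (M.s x) • M.ν) A = _
  rw [Measure.sub_apply hA (M.smul_nu_le x)]
  simp

/-- The kernel `G_{s,ν} = ∑_{ℓ ≥ 0} (P - s ⊗ ν)^ℓ`. -/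
def G : Kernel E E := Kernel.sum fun ℓ : ℕ => M.H ^ ℓ

/-- The invariant measure `π_s = ν G_{s,ν}`. -/
def piS : Measure E := M.ν.bind M.G

/-- The transition probability `Q` in the mixture `P = (1 - s) Q + s ν`, with the convention
`Q(x, ·) = δ_x` where `s x = 1`. -/
def Q : Kernel E E where
  toFun x := if M.s x < 1 then (ENNReal.ofReal (1 - M.s x))⁻¹ • M.H x else Measure.dirac x
  measurable' := by
    refine Measurable.ite (measurableSet_lt M.measurable_s measurable_const) ?_
      Measure.measurable_dirac
    refine Measure.measurable_of_measurable_coe _ fun A hA => ?_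
    simp only [Measure.smul_apply, smul_eq_mul]
    exact ((measurable_const.sub M.measurable_s).ennreal_ofReal.inv).mul
      (Kernel.measurable_coe M.H hA)

instance : IsMarkovKernel M.Q where
  isProbabilityMeasure x := by
    change IsProbabilityMeasure
      (if M.s x < 1 then (ENNReal.ofReal (1 - M.s x))⁻¹ • M.H x else Measure.dirac x)
    split_ifs with h
    · constructor
      have h1 : (1 : ℝ≥0∞) - ENNReal.ofReal (M.s x) = ENNReal.ofReal (1 - M.s x) := by
        rw [ENNReal.ofReal_sub _ (M.s_nonneg x), ENNReal.ofReal_one]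
      simp only [Measure.smul_apply, smul_eq_mul, M.H_apply x MeasurableSet.univ, measure_univ,
        mul_one, h1]
      exact ENNReal.inv_mul_cancel (by simpa using h) ENNReal.ofReal_ne_top
    · infer_instance

/-- Given `X_t = x`, the regeneration indicator `Y_t` equals `1` (`true`) with probability `s x`
and `0` (`false`) with probability `1 - s x`. -/
def coin : Kernel E Bool where
  toFun x := ENNReal.ofReal (M.s x) • Measure.dirac true +
    ENNReal.ofReal (1 - M.s x) • Measure.dirac false
  measurable' := by
    refine Measure.measurable_of_measurable_coe _ fun A hA => ?_
    simp only [Measure.add_apply, Measure.smul_apply, smul_eq_mul]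
    exact (M.measurable_s.ennreal_ofReal.mul_const _).add
      ((measurable_const.sub M.measurable_s).ennreal_ofReal.mul_const _)

instance : IsMarkovKernel M.coin where
  isProbabilityMeasure x := by
    constructor
    change (ENNReal.ofReal (M.s x) • Measure.dirac true +
      ENNReal.ofReal (1 - M.s x) • Measure.dirac false : Measure Bool) Set.univ = 1
    simp only [Measure.add_apply, Measure.smul_apply, smul_eq_mul, measure_univ, mul_one]
    rw [← ENNReal.ofReal_add (M.s_nonneg x) (by linarith [M.s_le_one x])]
    simp

/-- Law of `X_{t+1}` given `(X_t, Y_t) = (x, y)`: it is `ν` if `y = 1` and `Q(x, ·)` if `y = 0`. -/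
def nextState : Kernel (E × Bool) E where
  toFun z := if z.2 = true then M.ν else M.Q z.1
  measurable' :=
    Measurable.ite (measurable_snd (measurableSet_singleton true)) measurable_const
      (M.Q.measurable.comp measurable_fst)

instance : IsMarkovKernel M.nextState where
  isProbabilityMeasure z := by
    change IsProbabilityMeasure (if z.2 = true then M.ν else M.Q z.1)
    split_ifs <;> infer_instance

/-- Transition probability of the split chain `(X_t, Y_t)`: draw `X_{t+1}` from `nextState`, then
`Y_{t+1}` from `coin` at `X_{t+1}`. -/
def splitKernel : Kernel (E × Bool) (E × Bool) :=
  M.nextState.compProd (M.coin.comap Prod.snd measurable_snd)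

instance : IsMarkovKernel M.splitKernel := by
  unfold splitKernel; infer_instance

/-- The law `ℙ_ν` of the split chain when `X_0` has distribution `ν`. -/
def splitLaw : Measure (ℕ → E × Bool) :=
  chainLaw M.splitKernel (M.ν.compProd M.coin)

/-- The first regeneration time `τ = min {t ≥ 0 : Y_t = 1}` of a path of the split chain (with
value `0` on the set of paths that never regenerate). -/
def tau (ω : ℕ → E × Bool) : ℕ := sInf {t : ℕ | (ω t).2 = true}

/-- The block sum `U_0(g) = ∑_{t=0}^{τ} g(X_t)`. -/
def blockSum (g : E → ℝ) (ω : ℕ → E × Bool) : ℝ :=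
  ∑ t ∈ Finset.range (tau ω + 1), g (ω t).1

/-- The block variance `σ²(g) = Var_ν (U_0(g))`. -/
def blockVar (g : E → ℝ) : ℝ := variance (blockSum g) M.splitLaw

/-- `μ_g = π_s g`. -/
def mean (g : E → ℝ) : ℝ := ∫ x, g x ∂M.piS

/-- `g_0 = g - s μ_g`. -/
def center (g : E → ℝ) (x : E) : ℝ := g x - M.s x * M.mean g

/-- The signed measure `φ_g = π_s I_g P - μ_g ν`, as a functional `h ↦ φ_g h`. -/
def phi (g h : E → ℝ) : ℝ :=
  (∫ x, g x * (∫ y, h y ∂(M.P x)) ∂M.piS) - M.mean g * ∫ y, h y ∂M.ν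

/-- The function `P^k h`. -/
def powApply (k : ℕ) (h : E → ℝ) (x : E) : ℝ := ∫ y, h y ∂((M.P ^ k) x)

/-- The generalized cross-covariance function `γ_{g,f}(ℓ)`, `ℓ ∈ ℤ`:
`π_s I_{g_0} f_0 + μ_g μ_f (1 - π_s s²)` for `ℓ = 0`, `φ_g P^{ℓ-1} f_0` for `ℓ ≥ 1`, and
`γ_{f,g}(-ℓ)` for `ℓ < 0`. -/
def crossCov (g f : E → ℝ) : ℤ → ℝ
  | Int.ofNat 0 => (∫ x, M.center g x * M.center f x ∂M.piS) +
      M.mean g * M.mean f * (1 - ∫ x, M.s x ^ 2 ∂M.piS)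
  | Int.ofNat (k + 1) => M.phi g (M.powApply k (M.center f))
  | Int.negSucc k => M.phi f (M.powApply k (M.center g))

/-- The generalized autocovariance function `γ_g = γ_{g,g}`. -/
def autoCov (g : E → ℝ) : ℤ → ℝ := M.crossCov g g

end AtomicChain

end

noncomputable section

/-! ### Renewal sequences on the integers: consecutive terms merge, with no finite mean assumed. -/

section Renewal

/-! Write H = P - s⊗ν and F = Gg. If G|g| is bounded, F solves Poisson's equation F - PF = g - s·νF
= g₀, because νF = π_s g = μ_g. Hence the covariances telescope: Σ_{k<n} φ_g(P^k g₀) = φ_g(F) -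
φ_g(P^n F). Two facts finish the small case.

The remainder φ_g(P^n F) = π_s(g·(P^{n+1}F - νP^n F)) tends to 0. Decomposing at the last
regeneration shows that νP^n g₀ is a convolution with the renewal sequence u minus μ_g u_{n+1}. It
tends to 0 because u_{n+1} - u_n → 0 for an aperiodic recurrent renewal sequence
(`renewal_sub_tendsto`), whether or not the mean is finite. As νP^n g₀ is the increment of νP^n F, a
coupling-type recursion gives P^n F(x) - νP^n F → 0 wherever regeneration is certain
(`powApply_sub_tendsto`), hence π_s-a.e., and dominated convergence applies.

The variance has a closed form. On a path of the split chain, U₀(g)² + U₀(g²) is twice the sum of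
g(X_t)g(X_{t+r}) over t + r ≤ τ, and the law of (X_t, X_{t+r}) on {t + r ≤ τ} is νH^t ⊗ H^r.
Summation gives σ²(g) = 2π_s(g·Gg) - π_s(g²) - μ_g² (`blockVar_eq`), and algebra identifies this
with γ_g(0) + 2φ_g(F).

Small functions have bounded potentials: smallness and irreducibility give |g| ≤ c⁻¹ P^{N} s for
some N, while G P^N s ≤ N + 1. Harris recurrence makes the expected number of regenerations
infinite, hence regeneration certain under ν, π_s invariant and π_s(s) = 1.

The extension to g is dominated convergence at two levels. Covariances are integrals over the pair
law π_s ⊗ P^ℓ, both of whose marginals are π_s, and |U₀(g_n)| ≤ U₀(|g|) almost surely, with U₀(|g|)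
square integrable. Under (iv), subtracting the fixed series η_n b_ℓ leaves summands with a summable
bound uniform in n, so limit and sum may be exchanged (`hasBilateralSum_of_tendsto`). -/

theorem renewal_bounds {p u : ℕ → ℝ} (hp0 : ∀ j, 0 ≤ p j) (hp : HasSum p 1) (hu0 : u 0 = 1)
    (hu : ∀ n, u (n + 1) = ∑ j ∈ Finset.range (n + 1), p j * u (n - j)) (n : ℕ) :
    0 ≤ u n ∧ u n ≤ 1 := by
  induction n using Nat.strong_induction_on with
  | _ n ih =>
    rcases n with _ | n
    · simp [hu0]
    · rw [hu]
      refine ⟨Finset.sum_nonneg fun j _ => mul_nonneg (hp0 j) (ih _ (by omega)).1, ?_⟩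
      calc ∑ j ∈ Finset.range (n + 1), p j * u (n - j)
          ≤ ∑ j ∈ Finset.range (n + 1), p j :=
            Finset.sum_le_sum fun j _ => mul_le_of_le_one_right (hp0 j) (ih _ (by omega)).2
        _ ≤ 1 := sum_le_hasSum _ (fun j _ => hp0 j) hp

/-- A bounded function on `ℤ` which is harmonic for a random walk does not increase along a step
of the walk. -/
theorem harmonic_step_le {p : ℕ → ℝ} (hp0 : ∀ j, 0 ≤ p j) (hp : HasSum p 1) {y : ℤ → ℝ}
    (hy : ∀ j, |y j| ≤ 1) (hh : ∀ j : ℤ, HasSum (fun i : ℕ => p i * y (j - i)) (y (j + 1)))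
    {i : ℕ} (hi : 0 < p i) (j : ℤ) : y (j + (i + 1 : ℕ)) ≤ y j := by
  set a : ℤ := ((i + 1 : ℕ) : ℤ) with ha
  set D : ℤ → ℝ := fun j => y (j + a) - y j with hD
  have hbdd : BddAbove (Set.range D) := by
    refine ⟨2, ?_⟩
    rintro _ ⟨k, rfl⟩
    have h1 := abs_le.1 (hy (k + a))
    have h2 := abs_le.1 (hy k)
    simp only [hD]; linarith
  set S := ⨆ k, D k with hS
  have hDS : ∀ k, D k ≤ S := fun k => le_ciSup hbdd k
  have hDh : ∀ k : ℤ, HasSum (fun l : ℕ => p l * D (k - l)) (D (k + 1)) := by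
    intro k
    have h := (hh (k + a)).sub (hh k)
    have e : k + a + 1 = k + 1 + a := by ring
    rw [e] at h
    refine h.congr_fun fun l => ?_
    have e' : k - l + a = k + a - l := by ring
    simp only [hD, e']; ring
  have hstep : ∀ k : ℤ, D (k + 1) ≤ S - p i * (S - D (k - i)) := by
    intro k
    have h1 : HasSum (fun l : ℕ => p l * (S - D (k - l))) (S - D (k + 1)) := by
      have := (hp.mul_right S).sub (hDh k)
      rw [one_mul] at this
      refine this.congr_fun fun l => ?_
      ring
    have := sum_le_hasSum {i} (fun l _ => mul_nonneg (hp0 l) (sub_nonneg.2 (hDS _))) h1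
    simp only [Finset.sum_singleton] at this
    linarith
  have hiter : ∀ (r : ℕ) (k : ℤ), S - D (k - r * a) ≤ (S - D k) / p i ^ r := by
    intro r
    induction r with
    | zero => intro k; simp
    | succ r ih =>
      intro k
      have h1 := ih (k - a)
      have h2 := hstep (k - 1)
      have e1 : k - 1 + 1 = k := by ring
      have e2 : k - 1 - (i : ℤ) = k - a := by rw [ha]; push_cast; ring
      have e3 : k - ((r + 1 : ℕ) : ℤ) * a = k - a - r * a := by push_cast; ring
      rw [e1, e2] at h2
      rw [e3]
      refine h1.trans ?_
      rw [pow_succ', ← div_div]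
      gcongr
      rw [le_div_iff₀ hi]
      linarith
  -- Start at a point `k` where `D` almost attains `S`. Then `D` is almost `S` at `R` successive
  -- points, while its sum over them telescopes to a difference of values of `y`, at most 2. The
  -- tolerance `1 / (T + 1)` keeps the accumulated error below 1, whence the 3.
  have hSle : ∀ R : ℕ, R * S ≤ 3 := by
    intro R
    set T := ∑ r ∈ Finset.range R, 1 / p i ^ r with hT
    have hT0 : 0 ≤ T := Finset.sum_nonneg fun r _ => by positivity
    obtain ⟨k, hk⟩ := exists_lt_of_lt_ciSup
      (show S - 1 / (T + 1) < ⨆ k, D k by rw [← hS]; linarith [show 0 < 1 / (T + 1) by positivity])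
    have h1 : ∑ r ∈ Finset.range R, D (k - r * a) = y (k + a) - y (k + a - R * a) := by
      clear hk hT hT0 T
      induction R with
      | zero => simp
      | succ R ih =>
        rw [Finset.sum_range_succ, ih]
        simp only [hD]
        have e1 : k - R * a + a = k + a - R * a := by ring
        have e2 : k + a - ((R + 1 : ℕ) : ℤ) * a = k - R * a := by push_cast; ring
        rw [e1, e2]; ring
    have h2 : ∑ r ∈ Finset.range R, (S - D (k - r * a)) ≤ (S - D k) * T := by
      rw [hT, Finset.mul_sum]
      refine Finset.sum_le_sum fun r _ => (hiter r k).trans (le_of_eq ?_)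
      ring
    rw [Finset.sum_sub_distrib, h1] at h2
    simp only [Finset.sum_const, Finset.card_range, nsmul_eq_mul] at h2
    have h3 : (S - D k) * T ≤ 1 := by
      have : S - D k ≤ 1 / (T + 1) := by linarith
      calc (S - D k) * T ≤ 1 / (T + 1) * T := by gcongr
        _ ≤ 1 := by rw [one_div, inv_mul_le_iff₀ (by positivity)]; linarith
    have h4 := abs_le.1 (hy (k + a))
    have h5 := abs_le.1 (hy (k + a - R * a))
    linarith
  have hS0 : S ≤ 0 := by
    by_contra! h
    obtain ⟨R, hR⟩ := exists_nat_gt (3 / S)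
    rw [div_lt_iff₀ h] at hR
    linarith [hSle R]
  have := (hDS j).trans hS0
  simp only [hD] at this
  linarith

theorem harmonic_const {p : ℕ → ℝ} (hp0 : ∀ j, 0 ≤ p j) (hp : HasSum p 1)
    (haper : ∀ d : ℕ, 2 ≤ d → ∃ j, 0 < p j ∧ ¬ d ∣ j + 1) {y : ℤ → ℝ}
    (hy : ∀ j, |y j| ≤ 1) (hh : ∀ j : ℤ, HasSum (fun i : ℕ => p i * y (j - i)) (y (j + 1)))
    (j : ℤ) : y (j + 1) = y j := by
  -- The periods of `y`. Applying `harmonic_step_le` to `y` and to `-y` puts every possible step in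
  -- `A`; aperiodicity then forces `A` to be all of ℤ.
  let A : AddSubgroup ℤ :=
    { carrier := {a | ∀ j, y (j + a) = y j}
      zero_mem' := by intro j; simp
      add_mem' := by
        intro a b ha hb j
        rw [← add_assoc, hb, ha]
      neg_mem' := by
        intro a ha j
        have := ha (j + -a)
        rw [← this]; simp }
  have hmem : ∀ i : ℕ, 0 < p i → ((i + 1 : ℕ) : ℤ) ∈ A := by
    intro i hi k
    refine le_antisymm (harmonic_step_le hp0 hp hy hh hi k) ?_
    have := harmonic_step_le hp0 hp (y := fun j => - y j) (by simpa using hy)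
      (fun j => by simpa using (hh j).neg) hi k
    simpa using this
  obtain ⟨d, hd⟩ := Int.subgroup_cyclic A
  have hdvd : ∀ i : ℕ, 0 < p i → d.natAbs ∣ i + 1 := by
    intro i hi
    have := hmem i hi
    rw [hd, ← AddSubgroup.zmultiples_eq_closure, Int.mem_zmultiples_iff] at this
    exact Int.natCast_dvd_natCast.1 (Int.natAbs_dvd.2 this)
  have hd1 : d.natAbs = 1 := by
    by_contra hne
    rcases Nat.lt_or_ge d.natAbs 2 with h | h
    · obtain ⟨i, hi, -⟩ := haper 2 le_rfl
      have := hdvd i hi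
      have h0 : d.natAbs = 0 := by omega
      rw [h0] at this
      simp at this
    · obtain ⟨i, hi, hn⟩ := haper _ h
      exact hn (hdvd i hi)
  have h1 : (1 : ℤ) ∈ A := by
    rw [hd, ← AddSubgroup.zmultiples_eq_closure, Int.mem_zmultiples_iff]
    exact Int.isUnit_iff_natAbs_eq.2 hd1 |>.dvd
  exact h1 j

/-- For an aperiodic renewal sequence, consecutive terms become close. -/
theorem renewal_sub_tendsto {p u : ℕ → ℝ} (hp0 : ∀ j, 0 ≤ p j) (hp : HasSum p 1)
    (haper : ∀ d : ℕ, 2 ≤ d → ∃ j, 0 < p j ∧ ¬ d ∣ j + 1) (hu0 : u 0 = 1)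
    (hu : ∀ n, u (n + 1) = ∑ j ∈ Finset.range (n + 1), p j * u (n - j)) :
    Tendsto (fun n => u (n + 1) - u n) atTop (𝓝 0) := by
  have hb := renewal_bounds hp0 hp hu0 hu
  -- Extension by zero to ℤ. The renewal equation then holds on nonnegative indices only, which is
  -- all that survives after shifting to infinity.
  let U : ℤ → ℝ := fun k => if 0 ≤ k then u k.toNat else 0
  have hUb : ∀ k, U k ∈ Set.Icc (0 : ℝ) 1 := by
    intro k
    simp only [U]
    split_ifs
    · exact hb _
    · simp
  have hUh : ∀ k : ℤ, 0 ≤ k → HasSum (fun i : ℕ => p i * U (k - i)) (U (k + 1)) := by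
    intro k hk
    lift k to ℕ using hk
    have h1 : U (k + 1) = ∑ i ∈ Finset.range (k + 1), p i * U (k - i) := by
      have e : ((k : ℤ) + 1).toNat = k + 1 := by omega
      simp only [U]
      rw [if_pos (by omega), e, hu]
      refine Finset.sum_congr rfl fun i hi => ?_
      rw [Finset.mem_range] at hi
      have e : ((k : ℤ) - i).toNat = k - i := by omega
      rw [if_pos (by omega), e]
    rw [h1]
    refine hasSum_sum_of_ne_finset_zero fun i hi => ?_
    rw [Finset.mem_range] at hi
    simp only [U]
    rw [if_neg (by omega), mul_zero]
  -- Along an ultrafilter all shifts `U (n + j)` converge at once. The limits form a bounded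
  -- harmonic function on ℤ, which is constant by `harmonic_const`.
  rw [tendsto_iff_ultrafilter]
  intro 𝓤 h𝓤
  have hlim : ∀ j : ℤ, ∃ y, |y| ≤ 1 ∧ Tendsto (fun n : ℕ => U (n + j)) 𝓤 (𝓝 y) := by
    intro j
    obtain ⟨y, hy, hle⟩ := isCompact_Icc.ultrafilter_le_nhds (𝓤.map fun n : ℕ => U (n + j))
      (s := Set.Icc (0 : ℝ) 1) (by
        rw [le_principal_iff]
        exact Ultrafilter.mem_map.2 (Filter.univ_mem' fun n => hUb _))
    exact ⟨y, abs_le.2 ⟨by linarith [hy.1], hy.2⟩, hle⟩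
  choose y hy hyl using hlim
  have hharm : ∀ j : ℤ, HasSum (fun i : ℕ => p i * y (j - i)) (y (j + 1)) := by
    intro j
    have hsum : Summable fun i : ℕ => p i * y (j - i) := by
      refine Summable.of_norm_bounded hp.summable fun i => ?_
      rw [norm_mul, Real.norm_of_nonneg (hp0 i)]
      exact mul_le_of_le_one_right (hp0 i) (hy _)
    have h1 : Tendsto (fun n : ℕ => ∑' i : ℕ, p i * U (n + (j - i))) 𝓤
        (𝓝 (∑' i : ℕ, p i * y (j - i))) := by
      refine tendsto_tsum_of_dominated_convergence hp.summable
        (fun i => (hyl (j - i)).const_mul _) (Eventually.of_forall fun n i => ?_)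
      rw [norm_mul, Real.norm_of_nonneg (hp0 i), Real.norm_of_nonneg (hUb _).1]
      exact mul_le_of_le_one_right (hp0 i) (hUb _).2
    have h2 : ∀ᶠ n : ℕ in (𝓤 : Filter ℕ), ∑' i : ℕ, p i * U (n + (j - i)) = U (n + (j + 1)) := by
      refine h𝓤 ?_
      filter_upwards [eventually_ge_atTop j.natAbs] with n hn
      have := (hUh (n + j) (by omega)).tsum_eq
      simpa only [add_sub_assoc, add_assoc] using this
    have h3 := tendsto_nhds_unique (h1.congr' h2) (hyl (j + 1))
    rw [← h3]
    exact hsum.hasSum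
  have h01 := harmonic_const hp0 hp haper hy hharm 0
  have h2 := (hyl (0 + 1)).sub (hyl 0)
  rw [h01, sub_self] at h2
  refine h2.congr fun n => ?_
  have e : ((n : ℤ) + (0 + 1)).toNat = n + 1 := by omega
  have e' : ((n : ℤ) + 0).toNat = n := by omega
  simp only [U]
  rw [if_pos (by omega), if_pos (by omega), e, e']

/-- For fixed `j` the values `u (n - j)` and `u (n + 1)` merge, and the summable `|a j|` dominates.
Convergence of `u` itself is not needed. -/
theorem convolution_sub_tendsto {u a : ℕ → ℝ} {A : ℝ} (hb : ∀ n, 0 ≤ u n ∧ u n ≤ 1)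
    (hu : Tendsto (fun n => u (n + 1) - u n) atTop (𝓝 0)) (ha : HasSum a A) :
    Tendsto (fun n => ∑ j ∈ Finset.range (n + 1), a j * u (n - j) - A * u (n + 1)) atTop (𝓝 0) := by
  let U : ℕ → ℕ → ℝ := fun n j => if j ≤ n then u (n - j) else 0
  have hUb : ∀ n j, U n j ∈ Set.Icc (0 : ℝ) 1 := by
    intro n j
    simp only [U]
    split_ifs
    · exact hb _
    · simp
  have hU0 : ∀ j, Tendsto (fun n => U n j - u (n + 1)) atTop (𝓝 0) := by
    intro j
    have h1 : Tendsto (fun n => u n - u (n + (j + 1))) atTop (𝓝 0) := by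
      induction j with
      | zero => simpa using hu.neg
      | succ j ih =>
        have h2 := hu.comp (tendsto_add_atTop_nat (j + 1))
        have h3 := ih.sub h2
        rw [sub_zero] at h3
        refine h3.congr fun n => ?_
        simp only [Function.comp, add_assoc]
        ring
    rw [← tendsto_add_atTop_iff_nat j]
    refine h1.congr fun n => ?_
    simp only [U]
    rw [if_pos (by omega), Nat.add_sub_cancel, add_assoc]
  have h1 : Tendsto (fun n => ∑' j, a j * (U n j - u (n + 1))) atTop (𝓝 (∑' _ : ℕ, (0 : ℝ))) := by
    refine tendsto_tsum_of_dominated_convergence ha.summable.abs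
      (fun j => by simpa using (hU0 j).const_mul (a j)) (Eventually.of_forall fun n j => ?_)
    rw [norm_mul, Real.norm_eq_abs]
    refine mul_le_of_le_one_right (abs_nonneg _) ?_
    rw [Real.norm_eq_abs, abs_le]
    have := hUb n j
    have h' := hb (n + 1)
    constructor <;> linarith [this.1, this.2]
  rw [tsum_zero] at h1
  refine h1.congr fun n => ?_
  have h2 : HasSum (fun j => a j * U n j) (∑ j ∈ Finset.range (n + 1), a j * u (n - j)) := by
    have : ∑ j ∈ Finset.range (n + 1), a j * u (n - j)
        = ∑ j ∈ Finset.range (n + 1), a j * U n j := by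
      refine Finset.sum_congr rfl fun j hj => ?_
      rw [Finset.mem_range] at hj
      simp only [U]
      rw [if_pos (by omega)]
    rw [this]
    refine hasSum_sum_of_ne_finset_zero fun j hj => ?_
    rw [Finset.mem_range] at hj
    simp only [U]
    rw [if_neg (by omega), mul_zero]
  have h3 := (h2.sub (ha.mul_right (u (n + 1)))).tsum_eq
  rw [← h3]
  exact tsum_congr fun j => by ring

end Renewal

namespace AtomicChain

variable {E : Type*} [MeasurableSpace E] (M : AtomicChain E)

/-! ### The taboo kernel, its potential, and bounded potentials of small functions. -/

section Potential

theorem pow_succ_eq_comp (K : Kernel E E) (n : ℕ) : K ^ (n + 1) = (K ^ n) ∘ₖ K := pow_succ K n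

theorem pow_succ_eq_comp' (K : Kernel E E) (n : ℕ) : K ^ (n + 1) = K ∘ₖ (K ^ n) := pow_succ' K n

theorem pow_zero_eq_id (K : Kernel E E) : K ^ 0 = Kernel.id := pow_zero K

theorem lintegral_pow_succ (K : Kernel E E) (n : ℕ) (x : E) {f : E → ℝ≥0∞} (hf : Measurable f) :
    ∫⁻ y, f y ∂(K ^ (n + 1)) x = ∫⁻ y, ∫⁻ z, f z ∂(K ^ n) y ∂K x := by
   rw [pow_succ_eq_comp, Kernel.lintegral_comp _ _ _ hf]

theorem lintegral_pow_succ' (K : Kernel E E) (n : ℕ) (x : E) {f : E → ℝ≥0∞} (hf : Measurable f) :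
    ∫⁻ y, f y ∂(K ^ (n + 1)) x = ∫⁻ y, ∫⁻ z, f z ∂K y ∂(K ^ n) x := by
  rw [pow_succ_eq_comp', Kernel.lintegral_comp _ _ _ hf]

theorem lintegral_pow_add (K : Kernel E E) (m n : ℕ) (x : E) {f : E → ℝ≥0∞} (hf : Measurable f) :
    ∫⁻ y, f y ∂(K ^ (m + n)) x = ∫⁻ y, ∫⁻ z, f z ∂(K ^ n) y ∂(K ^ m) x := by
  rw [add_comm, Kernel.pow_add, Kernel.lintegral_comp _ _ _ hf]

theorem lintegral_pow_zero (K : Kernel E E) (x : E) {f : E → ℝ≥0∞} (hf : Measurable f) :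
    ∫⁻ y, f y ∂(K ^ 0) x = f x := by
  rw [pow_zero_eq_id, Kernel.id_apply, lintegral_dirac' _ hf]

instance isMarkovKernel_pow (n : ℕ) : IsMarkovKernel (M.P ^ n) := by
  induction n with
  | zero => rw [pow_zero_eq_id]; infer_instance
  | succ n ih => rw [pow_succ_eq_comp]; infer_instance

theorem P_apply_eq (x : E) : M.P x = M.H x + ENNReal.ofReal (M.s x) • M.ν := by
  have : IsFiniteMeasure (ENNReal.ofReal (M.s x) • M.ν) :=
    isFiniteMeasure_of_le _ (M.smul_nu_le x)
  exact (Measure.sub_add_cancel_of_le (M.smul_nu_le x)).symm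

theorem H_le_P (x : E) : M.H x ≤ M.P x := by
  rw [M.P_apply_eq x]
  exact Measure.le_add_right le_rfl

instance : IsFiniteKernel M.H :=
  ⟨⟨1, ENNReal.one_lt_top, fun x => (M.H_le_P x Set.univ).trans prob_le_one⟩⟩

instance isFiniteKernel_H_pow (n : ℕ) : IsFiniteKernel (M.H ^ n) := by
  induction n with
  | zero => rw [pow_zero_eq_id]; infer_instance
  | succ n ih => rw [pow_succ_eq_comp]; infer_instance

instance : IsSFiniteKernel M.G := by unfold G; infer_instance

instance : SFinite M.piS := by unfold piS; infer_instance

theorem lintegral_P (x : E) (f : E → ℝ≥0∞) :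
    ∫⁻ y, f y ∂M.P x = ∫⁻ y, f y ∂M.H x + ENNReal.ofReal (M.s x) * ∫⁻ y, f y ∂M.ν := by
  rw [M.P_apply_eq x, lintegral_add_measure, lintegral_smul_measure, smul_eq_mul]

theorem measurable_ofReal_s : Measurable fun x => ENNReal.ofReal (M.s x) :=
  M.measurable_s.ennreal_ofReal

theorem H_univ_add (x : E) : M.H x Set.univ + ENNReal.ofReal (M.s x) = 1 := by
  have := M.lintegral_P x 1
  simpa using this.symm

theorem H_pow_univ_succ (n : ℕ) (x : E) :
    (M.H ^ (n + 1)) x Set.univ = ∫⁻ y, (M.H ^ n) y Set.univ ∂M.H x := by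
  have := lintegral_pow_succ M.H n x (f := fun _ => 1) measurable_const
  simpa using this

theorem H_pow_univ_le (n : ℕ) (x : E) : (M.H ^ n) x Set.univ ≤ 1 := by
  induction n generalizing x with
  | zero => rw [pow_zero_eq_id, measure_univ]
  | succ n ih =>
    rw [H_pow_univ_succ]
    calc _ ≤ ∫⁻ _, 1 ∂M.H x := lintegral_mono fun y => ih y
      _ = M.H x Set.univ := by simp
      _ ≤ 1 := (M.H_le_P x Set.univ).trans prob_le_one

theorem lintegral_G (x : E) (f : E → ℝ≥0∞) :
    ∫⁻ y, f y ∂M.G x = ∑' n, ∫⁻ y, f y ∂(M.H ^ n) x := by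
  rw [G, Kernel.sum_apply, lintegral_sum_measure]

theorem G_eq : M.G = Kernel.id + M.G ∘ₖ M.H := by
  refine Kernel.ext_fun fun x f hf => ?_
  rw [_root_.add_apply, lintegral_add_measure, Kernel.lintegral_comp _ _ _ hf,
    Kernel.id_apply, lintegral_dirac' _ hf, lintegral_G, tsum_eq_zero_add' ENNReal.summable,
    lintegral_pow_zero _ _ hf]
  simp_rw [lintegral_G]
  rw [lintegral_tsum fun n => hf.lintegral_kernel.aemeasurable]
  simp_rw [lintegral_pow_succ M.H _ x hf]

theorem lintegral_G_eq (x : E) {f : E → ℝ≥0∞} (hf : Measurable f) :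
    ∫⁻ y, f y ∂M.G x = f x + ∫⁻ y, ∫⁻ z, f z ∂M.G y ∂M.H x := by
  conv_lhs => rw [M.G_eq]
  rw [_root_.add_apply, lintegral_add_measure, Kernel.lintegral_comp _ _ _ hf,
    Kernel.id_apply, lintegral_dirac' _ hf]

theorem le_lintegral_G (x : E) {f : E → ℝ≥0∞} (hf : Measurable f) :
    f x ≤ ∫⁻ y, f y ∂M.G x := by
  rw [M.lintegral_G_eq x hf]
  exact le_self_add

theorem lintegral_G_H_le (x : E) {f : E → ℝ≥0∞} (hf : Measurable f) :
    ∫⁻ y, ∫⁻ z, f z ∂M.H y ∂M.G x ≤ ∫⁻ y, f y ∂M.G x := by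
  rw [lintegral_G, lintegral_G, tsum_eq_zero_add' (f := fun n => ∫⁻ y, f y ∂(M.H ^ n) x)
    ENNReal.summable]
  simp_rw [lintegral_pow_succ' M.H _ x hf]
  exact le_add_self

/-- Conservation of mass: the killed chain has regenerated at some time before `n` or is still alive
at time `n`. -/
theorem sum_H_pow_s (n : ℕ) (x : E) :
    ∑ l ∈ Finset.range n, ∫⁻ y, ENNReal.ofReal (M.s y) ∂(M.H ^ l) x + (M.H ^ n) x Set.univ = 1 := by
  induction n with
  | zero =>
    have := lintegral_pow_zero M.H x (f := fun _ => 1) measurable_const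
    simpa using this
  | succ n ih =>
    rw [← ih, Finset.sum_range_succ, add_assoc]
    congr 1
    have h1 := lintegral_pow_succ' M.H n x (f := fun _ => 1) measurable_const
    simp only [lintegral_one] at h1
    rw [h1, ← lintegral_add_left M.measurable_ofReal_s]
    simp_rw [add_comm (ENNReal.ofReal _), H_univ_add]
    simp

theorem lintegral_G_s_le (x : E) : ∫⁻ y, ENNReal.ofReal (M.s y) ∂M.G x ≤ 1 := by
  rw [lintegral_G]
  refine ENNReal.tsum_le_of_sum_range_le fun n => ?_
  rw [← M.sum_H_pow_s n x]
  exact le_self_add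

theorem lintegral_P_pow_s_le (n : ℕ) (x : E) :
    ∫⁻ y, ENNReal.ofReal (M.s y) ∂(M.P ^ n) x ≤ 1 := by
  calc _ ≤ ∫⁻ _, 1 ∂(M.P ^ n) x :=
        lintegral_mono fun y => by simpa using M.s_le_one y
    _ = 1 := by simp

/-- Since P^{n+1}s = H(P^n s) + s·νP^n s, GH ≤ G and Gs ≤ 1, each further power of P costs at most
1. -/
theorem lintegral_G_P_pow_s_le (n : ℕ) (x : E) :
    ∫⁻ y, ∫⁻ z, ENNReal.ofReal (M.s z) ∂(M.P ^ n) y ∂M.G x ≤ n + 1 := by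
  induction n with
  | zero =>
    simp_rw [lintegral_pow_zero _ _ M.measurable_ofReal_s]
    simpa using M.lintegral_G_s_le x
  | succ n ih =>
    simp_rw [lintegral_pow_succ M.P n _ M.measurable_ofReal_s, lintegral_P]
    rw [lintegral_add_left M.measurable_ofReal_s.lintegral_kernel.lintegral_kernel]
    push_cast
    gcongr
    · exact (M.lintegral_G_H_le x M.measurable_ofReal_s.lintegral_kernel).trans ih
    · refine le_trans (lintegral_mono fun y => ?_) (M.lintegral_G_s_le x)
      refine mul_le_of_le_one_right zero_le ?_
      calc _ ≤ ∫⁻ _, 1 ∂M.ν := lintegral_mono fun y => M.lintegral_P_pow_s_le n y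
        _ = 1 := by simp

theorem exists_P_pow_s_pos {φ : Measure E} (hs : IsPosFun φ M.s)
    (hirr : Kernel.IsIrreducible φ M.P) (x : E) :
    ∃ n, ∫⁻ y, ENNReal.ofReal (M.s y) ∂(M.P ^ n) x ≠ 0 := by
  obtain ⟨n, hn⟩ := hirr.irreducible (measurableSet_lt measurable_const M.measurable_s) hs.pos x
  refine ⟨n, fun h => hn.ne' ?_⟩
  rw [lintegral_eq_zero_iff M.measurable_ofReal_s] at h
  rw [← compl_compl {x | 0 < M.s x}]
  refine measure_mono_null ?_ h
  intro y hy
  simpa using hy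

/-- Small functions are bounded, and so are their potentials. -/
theorem IsSmall.exists_lintegral_G_le {φ : Measure E} (hs : IsPosFun φ M.s)
    (hirr : Kernel.IsIrreducible φ M.P) {g : E → ℝ} (hg : IsSmall φ M.P fun x => |g x|) :
    ∃ C : ℝ≥0∞, C ≠ ∞ ∧ ∀ x, ∫⁻ y, ‖g y‖ₑ ∂M.G x ≤ C := by
  obtain ⟨-, lam, hlam, b, hb, m, -, hmin⟩ := hg
  -- Otherwise `lam`-almost every point would never reach the support of `s`, contradicting
  -- irreducibility. With this `k`, P^{m+k}s dominates a positive multiple of |g|.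
  obtain ⟨k, hk⟩ : ∃ k, ∫⁻ x, ∫⁻ y, ENNReal.ofReal (M.s y) ∂(M.P ^ k) x ∂lam ≠ 0 := by
    by_contra! h
    have h0 : ∀ᵐ x ∂lam, ∀ k, ∫⁻ y, ENNReal.ofReal (M.s y) ∂(M.P ^ k) x = 0 := by
      rw [ae_all_iff]
      intro k
      exact (lintegral_eq_zero_iff M.measurable_ofReal_s.lintegral_kernel).1 (h k)
    have : NeBot (ae lam) := ae_neBot.2 hlam
    obtain ⟨x, hx⟩ := h0.exists
    obtain ⟨k, hk⟩ := M.exists_P_pow_s_pos hs hirr x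
    exact hk (hx k)
  set c := ENNReal.ofReal b * ∫⁻ x, ∫⁻ y, ENNReal.ofReal (M.s y) ∂(M.P ^ k) x ∂lam with hc
  have hc0 : c ≠ 0 := mul_ne_zero (by simpa using hb) hk
  have hle : ∀ x, ‖g x‖ₑ ≤ c⁻¹ * ∫⁻ y, ENNReal.ofReal (M.s y) ∂(M.P ^ (m + k)) x := by
    intro x
    have h1 : ENNReal.ofReal (b * |g x|) • lam ≤ (M.P ^ m) x := by
      refine Measure.le_iff.2 fun A hA => ?_
      simpa using hmin x A hA
    have h2 := lintegral_mono' h1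
      (le_refl fun y => ∫⁻ z, ENNReal.ofReal (M.s z) ∂(M.P ^ k) y)
    rw [lintegral_smul_measure, smul_eq_mul, ← lintegral_pow_add _ _ _ _ M.measurable_ofReal_s,
      ENNReal.ofReal_mul hb.le] at h2
    rw [mul_comm, ← div_eq_mul_inv, ENNReal.le_div_iff_mul_le (Or.inl hc0)
      (Or.inr ((M.lintegral_P_pow_s_le _ x).trans_lt ENNReal.one_lt_top).ne),
      ← ofReal_norm, Real.norm_eq_abs, hc]
    refine le_trans (le_of_eq ?_) h2
    ring
  refine ⟨c⁻¹ * ((m + k : ℕ) + 1), ENNReal.mul_ne_top (ENNReal.inv_ne_top.2 hc0)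
    (by finiteness), fun x => ?_⟩
  calc _ ≤ ∫⁻ y, c⁻¹ * ∫⁻ z, ENNReal.ofReal (M.s z) ∂(M.P ^ (m + k)) y ∂M.G x :=
        lintegral_mono hle
    _ = c⁻¹ * ∫⁻ y, ∫⁻ z, ENNReal.ofReal (M.s z) ∂(M.P ^ (m + k)) y ∂M.G x :=
        lintegral_const_mul _ M.measurable_ofReal_s.lintegral_kernel
    _ ≤ _ := by gcongr; exact M.lintegral_G_P_pow_s_le _ x

end Potential

/-! ### Certainty of regeneration and invariance of π_s. -/

section Invariant

/-- The law of `X_n` on the event of no regeneration before time `n`. -/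
def tabooLaw (n : ℕ) : Measure E := M.ν.bind (M.H ^ n : Kernel E E)

theorem lintegral_tabooLaw (n : ℕ) {f : E → ℝ≥0∞} (hf : Measurable f) :
    ∫⁻ x, f x ∂M.tabooLaw n = ∫⁻ x, ∫⁻ y, f y ∂(M.H ^ n) x ∂M.ν :=
  Measure.lintegral_bind (Kernel.aemeasurable _) hf.aemeasurable

theorem lintegral_tabooLaw_zero {f : E → ℝ≥0∞} (hf : Measurable f) :
    ∫⁻ x, f x ∂M.tabooLaw 0 = ∫⁻ x, f x ∂M.ν := by
  rw [lintegral_tabooLaw _ _ hf]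
  simp_rw [lintegral_pow_zero _ _ hf]

theorem lintegral_tabooLaw_succ (n : ℕ) {f : E → ℝ≥0∞} (hf : Measurable f) :
    ∫⁻ x, f x ∂M.tabooLaw (n + 1) = ∫⁻ x, ∫⁻ y, f y ∂M.H x ∂M.tabooLaw n := by
  rw [lintegral_tabooLaw _ _ hf, lintegral_tabooLaw _ _ hf.lintegral_kernel]
  simp_rw [lintegral_pow_succ' _ _ _ hf]

instance (n : ℕ) : IsFiniteMeasure (M.tabooLaw n) :=
  by unfold tabooLaw; infer_instance

theorem piS_eq_sum : M.piS = Measure.sum M.tabooLaw := by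
  refine Measure.ext_of_lintegral _ fun f hf => ?_
  rw [piS, Measure.lintegral_bind (Kernel.aemeasurable _) hf.aemeasurable, lintegral_sum_measure]
  simp_rw [lintegral_G, lintegral_tabooLaw _ _ hf]
  rw [lintegral_tsum fun n => hf.lintegral_kernel.aemeasurable]

theorem lintegral_piS (f : E → ℝ≥0∞) :
    ∫⁻ x, f x ∂M.piS = ∑' n, ∫⁻ x, f x ∂M.tabooLaw n := by
  rw [piS_eq_sum, lintegral_sum_measure]

theorem lintegral_piS' {f : E → ℝ≥0∞} (hf : Measurable f) :
    ∫⁻ x, f x ∂M.piS = ∫⁻ x, ∫⁻ y, f y ∂M.G x ∂M.ν :=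
  Measure.lintegral_bind (Kernel.aemeasurable _) hf.aemeasurable

theorem tabooLaw_zero : M.tabooLaw 0 = M.ν :=
  Measure.ext_of_lintegral _ fun _ hf => M.lintegral_tabooLaw_zero hf

theorem nu_le_piS : M.ν ≤ M.piS := by
  rw [piS_eq_sum, ← tabooLaw_zero]
  exact Measure.le_sum _ 0

theorem nonempty_state (M : AtomicChain E) : Nonempty E := by
  by_contra h
  rw [not_nonempty_iff] at h
  have : M.ν Set.univ = 1 := measure_univ
  rw [Set.univ_eq_empty_iff.2 h, measure_empty] at this
  exact zero_ne_one this

/-- The probability of never regenerating. -/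
def escape (x : E) : ℝ≥0∞ := ⨅ n, (M.H ^ n) x Set.univ

theorem measurable_escape : Measurable M.escape :=
  Measurable.iInf fun _ => Kernel.measurable_coe _ MeasurableSet.univ

theorem escape_le_one (x : E) : M.escape x ≤ 1 := (iInf_le _ 0).trans (M.H_pow_univ_le 0 x)

theorem antitone_H_pow_univ (x : E) : Antitone fun n => (M.H ^ n) x Set.univ := by
  refine antitone_nat_of_succ_le fun n => ?_
  induction n generalizing x with
  | zero =>
    have := lintegral_pow_zero M.H x (f := fun _ => 1) measurable_const
    simp only [lintegral_one] at this
    rw [this]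
    exact M.H_pow_univ_le _ x
  | succ n ih =>
    rw [H_pow_univ_succ, H_pow_univ_succ M n]
    exact lintegral_mono fun y => ih y

theorem tendsto_escape (x : E) :
    Tendsto (fun n => (M.H ^ n) x Set.univ) atTop (𝓝 (M.escape x)) :=
  tendsto_atTop_iInf (M.antitone_H_pow_univ x)

theorem lintegral_H_escape (x : E) : ∫⁻ y, M.escape y ∂M.H x = M.escape x := by
  have h : ∫⁻ y, M.escape y ∂M.H x = ⨅ n, ∫⁻ y, (M.H ^ n) y Set.univ ∂M.H x := by
    refine lintegral_iInf (fun n => Kernel.measurable_coe _ MeasurableSet.univ)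
      (fun _ _ h y => M.antitone_H_pow_univ y h) ?_
    refine ((lintegral_mono fun y => M.H_pow_univ_le 0 y).trans_lt ?_).ne
    simp
  rw [h]
  simp_rw [← H_pow_univ_succ]
  refine tendsto_nhds_unique (tendsto_atTop_iInf fun m n h => ?_)
    ((M.tendsto_escape x).comp (tendsto_add_atTop_nat 1))
  exact M.antitone_H_pow_univ x (Nat.succ_le_succ h)

/-- The escape probability h satisfies Hh = h, hence Ph = h + s·νh, and each application of P adds
another term. As h ≤ 1, an infinite sum of P^k s forces νh = 0. -/
theorem sum_P_pow_s_mul_escape_le (n : ℕ) (x : E) :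
    (∑ k ∈ Finset.range n, ∫⁻ y, ENNReal.ofReal (M.s y) ∂(M.P ^ k) x) * ∫⁻ y, M.escape y ∂M.ν
      ≤ ∫⁻ y, M.escape y ∂(M.P ^ n) x := by
  induction n with
  | zero => simp
  | succ n ih =>
    rw [lintegral_pow_succ' _ _ _ M.measurable_escape, Finset.sum_range_succ, add_mul]
    simp_rw [lintegral_P, lintegral_H_escape]
    rw [lintegral_add_left M.measurable_escape, lintegral_mul_const _ M.measurable_ofReal_s]
    gcongr

theorem lintegral_nu_escape (hrec : ∀ x, ∑' k, ∫⁻ y, ENNReal.ofReal (M.s y) ∂(M.P ^ k) x = ∞) :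
    ∫⁻ x, M.escape x ∂M.ν = 0 := by
  obtain ⟨x⟩ := M.nonempty_state
  by_contra h
  have h1 : (∑' k, ∫⁻ y, ENNReal.ofReal (M.s y) ∂(M.P ^ k) x) * ∫⁻ y, M.escape y ∂M.ν ≤ 1 := by
    rw [← ENNReal.tsum_mul_right]
    refine ENNReal.tsum_le_of_sum_range_le fun n => ?_
    rw [← Finset.sum_mul]
    refine (M.sum_P_pow_s_mul_escape_le n x).trans ?_
    calc _ ≤ ∫⁻ _, 1 ∂(M.P ^ n) x := lintegral_mono M.escape_le_one
      _ = 1 := by simp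
  rw [hrec x, ENNReal.top_mul h] at h1
  simp at h1

theorem ae_escape_eq_zero (hν : ∫⁻ x, M.escape x ∂M.ν = 0) : ∀ᵐ x ∂M.piS, M.escape x = 0 := by
  have : ∫⁻ x, M.escape x ∂M.piS = 0 := by
    rw [lintegral_piS, ENNReal.tsum_eq_zero]
    intro n
    induction n with
    | zero => rw [lintegral_tabooLaw_zero _ M.measurable_escape, hν]
    | succ n ih =>
      rw [lintegral_tabooLaw_succ _ _ M.measurable_escape]
      simp_rw [lintegral_H_escape, ih]
  exact (lintegral_eq_zero_iff M.measurable_escape).1 this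

theorem tendsto_tabooLaw_univ (hν : ∫⁻ x, M.escape x ∂M.ν = 0) :
    Tendsto (fun n => M.tabooLaw n Set.univ) atTop (𝓝 0) := by
  have h : ∀ n, M.tabooLaw n Set.univ = ∫⁻ x, (M.H ^ n) x Set.univ ∂M.ν := by
    intro n
    simpa using M.lintegral_tabooLaw n (f := fun _ => 1) measurable_const
  simp_rw [h]
  rw [← hν]
  have h0 : ∫⁻ y, M.escape y ∂M.ν = ⨅ n, ∫⁻ y, (M.H ^ n) y Set.univ ∂M.ν := by
    refine lintegral_iInf (fun n => Kernel.measurable_coe _ MeasurableSet.univ)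
      (fun _ _ h y => M.antitone_H_pow_univ y h) ?_
    refine ((lintegral_mono fun y => M.H_pow_univ_le 0 y).trans_lt ?_).ne
    simp
  rw [h0]
  exact tendsto_atTop_iInf fun m n h => lintegral_mono fun y => M.antitone_H_pow_univ y h

theorem lintegral_piS_s (hν : ∫⁻ x, M.escape x ∂M.ν = 0) :
    ∫⁻ x, ENNReal.ofReal (M.s x) ∂M.piS = 1 := by
  rw [lintegral_piS]
  have h1 : ∀ n, ∑ l ∈ Finset.range n, ∫⁻ x, ENNReal.ofReal (M.s x) ∂M.tabooLaw l
      + M.tabooLaw n Set.univ = 1 := by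
    intro n
    have h : M.tabooLaw n Set.univ = ∫⁻ x, (M.H ^ n) x Set.univ ∂M.ν := by
      simpa using M.lintegral_tabooLaw n (f := fun _ => 1) measurable_const
    simp_rw [h, lintegral_tabooLaw _ _ M.measurable_ofReal_s]
    rw [← lintegral_finsetSum _ fun l _ => M.measurable_ofReal_s.lintegral_kernel,
      ← lintegral_add_right _ (Kernel.measurable_coe _ MeasurableSet.univ)]
    simp_rw [sum_H_pow_s]
    simp
  have h2 := (ENNReal.tendsto_nat_tsum fun l => ∫⁻ x, ENNReal.ofReal (M.s x) ∂M.tabooLaw l).add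
    (M.tendsto_tabooLaw_univ hν)
  simp_rw [h1, add_zero] at h2
  exact tendsto_nhds_unique h2 tendsto_const_nhds

/-- Shifting the series gives π_s H + ν = π_s, and π_s(s) = 1 makes s⊗ν contribute exactly ν. -/
theorem lintegral_piS_P (hν : ∫⁻ x, M.escape x ∂M.ν = 0) {f : E → ℝ≥0∞} (hf : Measurable f) :
    ∫⁻ x, ∫⁻ y, f y ∂M.P x ∂M.piS = ∫⁻ x, f x ∂M.piS := by
  simp_rw [lintegral_P]
  rw [lintegral_add_left hf.lintegral_kernel, lintegral_mul_const _ M.measurable_ofReal_s,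
    M.lintegral_piS_s hν, one_mul, lintegral_piS, lintegral_piS,
    tsum_eq_zero_add' (f := fun n => ∫⁻ x, f x ∂M.tabooLaw n) ENNReal.summable,
    lintegral_tabooLaw_zero _ hf, add_comm]
  simp_rw [lintegral_tabooLaw_succ _ _ hf]

theorem lintegral_piS_P_pow (hν : ∫⁻ x, M.escape x ∂M.ν = 0) (n : ℕ) {f : E → ℝ≥0∞}
    (hf : Measurable f) : ∫⁻ x, ∫⁻ y, f y ∂(M.P ^ n) x ∂M.piS = ∫⁻ x, f x ∂M.piS := by
  induction n with
  | zero => simp_rw [lintegral_pow_zero _ _ hf]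
  | succ n ih =>
    simp_rw [lintegral_pow_succ _ _ _ hf]
    rw [M.lintegral_piS_P hν hf.lintegral_kernel, ih]

theorem piS_bind_P_pow (hν : ∫⁻ x, M.escape x ∂M.ν = 0) (n : ℕ) :
    M.piS.bind (M.P ^ n : Kernel E E) = M.piS := by
  refine Measure.ext_of_lintegral _ fun f hf => ?_
  rw [Measure.lintegral_bind (Kernel.aemeasurable _) hf.aemeasurable,
    M.lintegral_piS_P_pow hν n hf]

end Invariant

/-! ### The renewal sequence of the chain and its aperiodicity. -/

section RenewalSequence

/-- The renewal sequence `u 0 = 1`, `u (n + 1) = ν P^n s`. -/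
def renewalSeq : ℕ → ℝ≥0∞
  | 0 => 1
  | n + 1 => ∫⁻ x, ∫⁻ y, ENNReal.ofReal (M.s y) ∂(M.P ^ n) x ∂M.ν

/-- Decomposition at the last regeneration before time `n`, a start from ν counting as a
regeneration at time -1. That regeneration occurs at time `n - j - 1`, with probability `renewalSeq
(n - j)`, and `j` taboo steps follow. -/
theorem lintegral_nu_P_pow (n : ℕ) {f : E → ℝ≥0∞} (hf : Measurable f) :
    ∫⁻ x, ∫⁻ y, f y ∂(M.P ^ n) x ∂M.ν =
      ∑ j ∈ Finset.range (n + 1), M.renewalSeq (n - j) * ∫⁻ x, f x ∂M.tabooLaw j := by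
  induction n generalizing f with
  | zero => 
    simp_rw [lintegral_pow_zero _ _ hf]
    simp [lintegral_tabooLaw_zero _ hf, renewalSeq]
  | succ n ih =>
    simp_rw [lintegral_pow_succ' _ _ _ hf, lintegral_P]
    simp_rw [lintegral_add_left hf.lintegral_kernel, lintegral_mul_const _ M.measurable_ofReal_s]
    rw [lintegral_add_left hf.lintegral_kernel.lintegral_kernel,
      lintegral_mul_const _ M.measurable_ofReal_s.lintegral_kernel, ih hf.lintegral_kernel,
      Finset.sum_range_succ' _ (n + 1), lintegral_tabooLaw_zero _ hf]
    simp_rw [lintegral_tabooLaw_succ _ _ hf, Nat.add_sub_add_right]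
    rfl

theorem renewalSeq_succ (n : ℕ) : M.renewalSeq (n + 1) =
    ∑ j ∈ Finset.range (n + 1),
      M.renewalSeq (n - j) * ∫⁻ x, ENNReal.ofReal (M.s x) ∂M.tabooLaw j :=
  M.lintegral_nu_P_pow n M.measurable_ofReal_s

/-- If `d` divided every possible cycle length `j + 1`, sorting states by the residue of the time
until a possible regeneration would exhibit a cycle of length `d`. -/
theorem exists_not_dvd {φ : Measure E} (hs : IsPosFun φ M.s)
    (hirr : Kernel.IsIrreducible φ M.P) (haper : IsAperiodic M.P) {d : ℕ} (hd : 2 ≤ d) :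
    ∃ j, ∫⁻ x, ENNReal.ofReal (M.s x) ∂M.tabooLaw j ≠ 0 ∧ ¬ d ∣ j + 1 := by
  by_contra! hdvd
  have hu : ∀ n, M.renewalSeq n ≠ 0 → d ∣ n := by
    intro n
    induction n using Nat.strong_induction_on with
    | _ n ih =>
      rcases n with _ | n
      · simp
      intro hn
      rw [renewalSeq_succ] at hn
      obtain ⟨j, hj, hj0⟩ := Finset.exists_ne_zero_of_sum_ne_zero hn
      rw [Finset.mem_range] at hj
      have h1 := ih (n - j) (by omega) (left_ne_zero_of_mul hj0)
      have h2 := hdvd j (right_ne_zero_of_mul hj0)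
      have := dvd_add h1 h2
      rwa [show n - j + (j + 1) = n + 1 by omega] at this
  set w : ℕ → E → ℝ≥0∞ := fun n x => ∫⁻ y, ENNReal.ofReal (M.s y) ∂(M.P ^ n) x with hw
  have hwm : ∀ n, Measurable (w n) := fun n => M.measurable_ofReal_s.lintegral_kernel
  -- From a point of `C i`, regeneration is possible after `n` steps only if `n ≡ -i` mod `d`. One
  -- step of P moves `C i` into `C (i + 1)`, and ν is carried by `C 1`. Disjointness holds since
  -- from every point some `n` is possible.
  set C : ZMod d → Set E := fun i => {x | ∀ n : ℕ, w n x ≠ 0 → (n : ZMod d) + i = 0} with hC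
  have hCm : ∀ i, MeasurableSet (C i) := by
    intro i
    have : C i = ⋂ n : ℕ, {x | w n x ≠ 0 → (n : ZMod d) + i = 0} := by
      ext x; simp [hC]
    rw [this]
    refine MeasurableSet.iInter fun n => ?_
    by_cases h : (n : ZMod d) + i = 0
    · simp [h]
    · have : {x | w n x ≠ 0 → (n : ZMod d) + i = 0} = w n ⁻¹' {0} := by
        ext x; simp [h]
      rw [this]
      exact hwm n (measurableSet_singleton 0)
  have hstep : ∀ i, ∀ x ∈ C i, M.P x (C (i + 1)) = 1 := by
    intro i x hx
    rw [prob_compl_eq_zero_iff (hCm _) |>.symm]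
    have h : ∀ᵐ y ∂M.P x, y ∈ C (i + 1) := by
      refine ae_all_iff.2 fun n => ?_
      by_cases hn : (n : ZMod d) + (i + 1) = 0
      · exact Eventually.of_forall fun _ _ => hn
      have h0 : w (n + 1) x = 0 := by
        by_contra h
        have := hx _ h
        apply hn
        rw [← this]; push_cast; ring
      simp only [hw] at h0
      rw [lintegral_pow_succ _ _ _ M.measurable_ofReal_s, lintegral_eq_zero_iff (hwm n)] at h0
      filter_upwards [h0] with y hy hy'
      exact absurd hy hy'
    exact h
  have hne1 : (C 1).Nonempty := by
    have h : ∀ᵐ y ∂M.ν, y ∈ C 1 := by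
      refine ae_all_iff.2 fun n => ?_
      by_cases hn : (n : ZMod d) + 1 = 0
      · exact Eventually.of_forall fun _ _ => hn
      have h0 : M.renewalSeq (n + 1) = 0 := by
        by_contra h
        apply hn
        have := (ZMod.natCast_eq_zero_iff (n + 1) d).2 (hu _ h)
        rw [← this]; push_cast; ring
      have h0' : ∫⁻ x, w n x ∂M.ν = 0 := h0
      rw [lintegral_eq_zero_iff (hwm n)] at h0'
      filter_upwards [h0'] with y hy hy'
      exact absurd hy hy'
    exact h.exists
  have hne : ∀ k : ℕ, (C (1 + k)).Nonempty := by
    intro k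
    induction k with
    | zero => simpa using hne1
    | succ k ih =>
      obtain ⟨x, hx⟩ := ih
      have h := hstep _ x hx
      push_cast
      rw [← add_assoc]
      refine nonempty_of_measure_ne_zero (μ := M.P x) ?_
      rw [h]; exact one_ne_zero
  have : NeZero d := ⟨by omega⟩
  refine haper d hd ⟨C, hCm, fun i => ?_, fun i j hij => ?_, hstep⟩
  · have := hne (i - 1).val
    rwa [ZMod.natCast_zmod_val, add_sub_cancel] at this
  · rw [Set.disjoint_left]
    intro x hi hj
    obtain ⟨n, hn⟩ := M.exists_P_pow_s_pos hs hirr x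
    exact hij (add_left_cancel ((hi n hn).trans (hj n hn).symm))

end RenewalSequence

end AtomicChain

/-! ### The Markov property for path laws. -/

section ChainLaw

variable {S : Type*} [MeasurableSpace S] (K : Kernel S S) [IsMarkovKernel K]
  (lam : Measure S) [IsProbabilityMeasure lam]

instance : IsProbabilityMeasure (chainLaw K lam) := by unfold chainLaw; infer_instance

theorem lintegral_chainLaw_zero {f : S → ℝ≥0∞} (hf : Measurable f) :
    ∫⁻ ω, f (ω 0) ∂chainLaw K lam = ∫⁻ x, f x ∂lam := by
  have h0 : ∀ (μ : Measure S) [IsProbabilityMeasure μ], (chainLaw K μ).map (fun ω => ω 0) = μ := by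
    intro μ _
    unfold chainLaw Kernel.trajMeasure
    have e : (fun ω : ℕ → S => ω 0) =
        (fun h : ((i : Finset.Iic 0) → (fun _ : ℕ => S) (i : ℕ)) => h ⟨0, by simp⟩) ∘
          Preorder.frestrictLe (π := fun _ : ℕ => S) 0 := rfl
    rw [e, ← Measure.map_map (by fun_prop) (by fun_prop), Measure.map_comp _ _ (by fun_prop),
      Kernel.traj_map_frestrictLe, Kernel.partialTraj_self, Measure.id_comp,
      Measure.map_map (by fun_prop) (by fun_prop)]
    exact Measure.map_id
  conv_rhs => rw [← h0 lam]
  rw [lintegral_map hf (measurable_pi_apply 0)]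

/-- The Markov property at time `n`, with an arbitrary nonnegative weight `W` on the past. -/
theorem lintegral_chainLaw_succ [Nonempty S] {n : ℕ} {W : (ℕ → S) → ℝ≥0∞} (hW : Measurable W)
    (hdep : DependsOn W (Set.Iic n)) {f : S → ℝ≥0∞} (hf : Measurable f) :
    ∫⁻ ω, W ω * f (ω (n + 1)) ∂chainLaw K lam =
      ∫⁻ ω, W ω * ∫⁻ y, f y ∂K (ω n) ∂chainLaw K lam := by
  obtain ⟨z⟩ := ‹Nonempty S›
  -- A finite history is padded by a constant so that `W` can be evaluated on it; the padding is
  -- invisible to `W`.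
  let ext : ((i : Finset.Iic n) → (fun _ : ℕ => S) (i : ℕ)) → ℕ → S :=
    fun h i => if hi : i ≤ n then h ⟨i, Finset.mem_Iic.2 hi⟩ else z
  have hext : Measurable ext := by
    refine measurable_pi_lambda _ fun i => ?_
    simp only [ext]
    split_ifs <;> fun_prop
  have hWe : ∀ ω : ℕ → S, W (ext (Preorder.frestrictLe (π := fun _ : ℕ => S) n ω)) = W ω := by
    intro ω
    refine hdep fun i hi => ?_
    simp only [ext]
    rw [dif_pos (Set.mem_Iic.1 hi)]
    rfl
  have key := Kernel.map_frestrictLe_trajMeasure_compProd_eq_map_trajMeasure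
    (X := fun _ : ℕ => S) (μ₀ := lam)
    (κ := fun n : ℕ => K.comap (fun h : ((i : Finset.Iic n) → (fun _ : ℕ => S) (i : ℕ)) =>
        h ⟨n, Finset.mem_Iic.mpr le_rfl⟩) (measurable_pi_apply _)) (a := n)
  have hWm : Measurable fun h => W (ext h) := hW.comp hext
  have h2 := congrArg (fun μ => ∫⁻ q, W (ext q.1) * f q.2 ∂μ) key
  have hq : Measurable fun q : ((i : Finset.Iic n) → (fun _ : ℕ => S) (i : ℕ)) × S =>
      W (ext q.1) * f q.2 := (hWm.comp measurable_fst).mul (hf.comp measurable_snd)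
  simp only at h2
  rw [Measure.lintegral_compProd hq, lintegral_map _ (by fun_prop),
    lintegral_map hq (by fun_prop)] at h2
  · simp only [hWe, Kernel.comap_apply] at h2
    refine h2.symm.trans (lintegral_congr fun ω => ?_)
    rw [lintegral_const_mul _ hf]
    rfl
  · exact Measurable.lintegral_kernel_prod_right' hq

theorem lintegral_chainLaw_eq_pow {E : Type*} [MeasurableSpace E] (P : Kernel E E)
    [IsMarkovKernel P] (x : E) (n : ℕ) {f : E → ℝ≥0∞} (hf : Measurable f) :
    ∫⁻ ω, f (ω n) ∂chainLaw P (Measure.dirac x) = ∫⁻ y, f y ∂(P ^ n) x := by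
  have : Nonempty E := ⟨x⟩
  induction n generalizing f with
  | zero =>
    rw [lintegral_chainLaw_zero _ _ hf, lintegral_dirac' _ hf,
      AtomicChain.lintegral_pow_zero _ _ hf]
  | succ n ih =>
    have := lintegral_chainLaw_succ P (Measure.dirac x) (n := n) (W := fun _ => 1)
      measurable_const (fun _ _ _ => rfl) hf
    simp only [one_mul] at this
    rw [this, ih hf.lintegral_kernel, AtomicChain.lintegral_pow_succ' _ _ _ hf]

end ChainLaw

namespace AtomicChain

variable {E : Type*} [MeasurableSpace E] (M : AtomicChain E)

/-- A finite expected sum of s(X_k) would force s(X_k) → 0 almost surely, whereas Harris recurrence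
returns the path infinitely often to some set {s > 1/(n+1)} of positive φ-measure. -/
theorem tsum_P_pow_s_eq_top {φ : Measure E} (hs : IsPosFun φ M.s)
    (hharris : IsHarrisRecurrent φ M.P) (x : E) :
    ∑' k, ∫⁻ y, ENNReal.ofReal (M.s y) ∂(M.P ^ k) x = ∞ := by
  by_contra hfin
  have hm : ∀ ε : ℝ, MeasurableSet {x | ε < M.s x} :=
    fun ε => measurableSet_lt measurable_const M.measurable_s
  obtain ⟨n, hn⟩ : ∃ n : ℕ, 0 < φ {x | 1 / ((n : ℝ) + 1) < M.s x} := by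
    by_contra! h
    refine hs.pos.ne' (measure_mono_null (t := ⋃ n : ℕ, {x | 1 / ((n : ℝ) + 1) < M.s x}) ?_ ?_)
    · intro x hx
      obtain ⟨n, hn⟩ := exists_nat_one_div_lt (show 0 < M.s x from hx)
      exact Set.mem_iUnion.2 ⟨n, hn⟩
    · exact measure_iUnion_null fun n => le_antisymm (h n) zero_le
  have hio := hharris _ (hm _) hn x
  simp_rw [← lintegral_chainLaw_eq_pow M.P x _ M.measurable_ofReal_s] at hfin
  have hsm : ∀ k, Measurable fun ω : ℕ → E => ENNReal.ofReal (M.s (ω k)) :=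
    fun k => M.measurable_ofReal_s.comp (measurable_pi_apply k)
  rw [← lintegral_tsum fun k => (hsm k).aemeasurable] at hfin
  have hlt := ae_lt_top (Measurable.tsum hsm) hfin
  obtain ⟨ω, hω1, hω2⟩ := (hio.and hlt).exists
  have h0 := ENNReal.tendsto_atTop_zero_of_tsum_ne_top hω2.ne
  have h1 : ∀ᶠ k in atTop, ENNReal.ofReal (M.s (ω k)) < ENNReal.ofReal (1 / ((n : ℝ) + 1)) :=
    h0.eventually_lt_const (by rw [ENNReal.ofReal_pos]; positivity)
  obtain ⟨k, hk1, hk2⟩ := (hω1.and_eventually h1).exists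
  rw [ENNReal.ofReal_lt_ofReal_iff (by positivity)] at hk2
  exact lt_asymm hk1 hk2

/-! ### The split chain before its first regeneration. -/

section Split

theorem lintegral_coin (x : E) (f : Bool → ℝ≥0∞) :
    ∫⁻ y, f y ∂M.coin x =
      ENNReal.ofReal (M.s x) * f true + ENNReal.ofReal (1 - M.s x) * f false := by
  change ∫⁻ y, f y ∂(ENNReal.ofReal (M.s x) • Measure.dirac true +
    ENNReal.ofReal (1 - M.s x) • Measure.dirac false) = _
  rw [lintegral_add_measure, lintegral_smul_measure, lintegral_smul_measure, lintegral_dirac,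
    lintegral_dirac, smul_eq_mul, smul_eq_mul]

/-- Where s(x) = 1 the measure H(x,·) has mass zero, so the convention chosen for Q there is
immaterial. -/
theorem one_sub_s_mul_lintegral_Q (x : E) (f : E → ℝ≥0∞) :
    ENNReal.ofReal (1 - M.s x) * ∫⁻ y, f y ∂M.Q x = ∫⁻ y, f y ∂M.H x := by
  have hQ : M.Q x = if M.s x < 1 then (ENNReal.ofReal (1 - M.s x))⁻¹ • M.H x
    else Measure.dirac x := rfl
  rw [hQ]
  split_ifs with h
  · rw [lintegral_smul_measure, smul_eq_mul, ← mul_assoc, ENNReal.mul_inv_cancel, one_mul]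
    · simpa using h
    · exact ENNReal.ofReal_ne_top
  · have h1 : M.s x = 1 := le_antisymm (M.s_le_one x) (not_lt.1 h)
    have h2 := M.H_univ_add x
    rw [h1, ENNReal.ofReal_one] at h2
    have h3 : M.H x = 0 := by
      rw [← Measure.measure_univ_eq_zero]
      exact (ENNReal.add_left_inj ENNReal.one_ne_top).1 (h2.trans (zero_add 1).symm)
    rw [h3, h1]
    simp

theorem lintegral_splitKernel (z : E × Bool) {f : E × Bool → ℝ≥0∞} (hf : Measurable f) :
    ∫⁻ w, f w ∂M.splitKernel z = ∫⁻ x, ∫⁻ y, f (x, y) ∂M.coin x ∂M.nextState z := by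
  rw [splitKernel, Kernel.lintegral_compProd _ _ _ hf]
  simp [Kernel.comap_apply]

instance : IsProbabilityMeasure M.splitLaw := by unfold splitLaw; infer_instance

/-- The indicator that the coordinate `z` of the split chain is not a regeneration. -/
def notRegen (z : E × Bool) : ℝ≥0∞ := if z.2 = true then 0 else 1

theorem notRegen_true {E : Type*} (x : E) : notRegen (x, true) = 0 := rfl

theorem notRegen_false {E : Type*} (x : E) : notRegen (x, false) = 1 := rfl

theorem measurable_notRegen : Measurable (notRegen (E := E)) :=
  Measurable.ite (measurable_snd (measurableSet_singleton true)) measurable_const measurable_const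

theorem measurable_lintegral_coin {f : E × Bool → ℝ≥0∞} (hf : Measurable f) :
    Measurable fun x => ∫⁻ y, f (x, y) ∂M.coin x :=
  Measurable.lintegral_kernel_prod_right' hf

/-- Given X_n and the strict past, Y_n is a fresh coin; hence `W` may only look at coordinates
before `n`. -/
theorem lintegral_splitLaw_coin {n : ℕ} {W : (ℕ → E × Bool) → ℝ≥0∞} (hW : Measurable W)
    (hdep : DependsOn W (Set.Iio n)) {f : E × Bool → ℝ≥0∞} (hf : Measurable f) :
    ∫⁻ ω, W ω * f (ω n) ∂M.splitLaw =
      ∫⁻ ω, W ω * ∫⁻ y, f ((ω n).1, y) ∂M.coin (ω n).1 ∂M.splitLaw := by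
  have : Nonempty E := M.nonempty_state
  have hfm := M.measurable_lintegral_coin hf
  rcases n with _ | n
  · obtain ⟨x⟩ := this
    have hc : ∀ ω, W ω = W fun _ => (x, true) := fun ω => hdep fun i hi => absurd hi (by simp)
    simp_rw [hc]
    have hf0 : Measurable fun ω : ℕ → E × Bool => f (ω 0) := hf.comp (measurable_pi_apply 0)
    have hfm0 : Measurable fun ω : ℕ → E × Bool => ∫⁻ y, f ((ω 0).1, y) ∂M.coin (ω 0).1 :=
      hfm.comp (measurable_fst.comp (measurable_pi_apply 0))
    rw [lintegral_const_mul _ hf0, lintegral_const_mul _ hfm0]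
    congr 1
    unfold splitLaw
    rw [lintegral_chainLaw_zero _ _ hf, Measure.lintegral_compProd hf,
      lintegral_chainLaw_zero _ _
        (f := fun z : E × Bool => ∫⁻ y, f (z.1, y) ∂M.coin z.1) (hfm.comp measurable_fst),
      Measure.lintegral_compProd (f := fun z : E × Bool => ∫⁻ y, f (z.1, y) ∂M.coin z.1)
        (hfm.comp measurable_fst)]
    simp only [lintegral_const, measure_univ, mul_one]
  · have hdep' : DependsOn W (Set.Iic n) := by
      intro x y h
      exact hdep fun i hi => h i (Nat.lt_succ_iff.1 hi)
    unfold splitLaw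
    rw [lintegral_chainLaw_succ _ _ hW hdep' hf, lintegral_chainLaw_succ _ _ hW hdep'
      (f := fun z : E × Bool => ∫⁻ y, f (z.1, y) ∂M.coin z.1) (hfm.comp measurable_fst)]
    simp_rw [M.lintegral_splitKernel _ hf, M.lintegral_splitKernel _
      (f := fun z : E × Bool => ∫⁻ y, f (z.1, y) ∂M.coin z.1) (hfm.comp measurable_fst)]
    simp only [lintegral_const, measure_univ, mul_one]

/-- A step on which no regeneration occurs is a step of H: the survival probability 1 - s cancels
the normalisation of Q. -/
theorem lintegral_splitLaw_succ {n : ℕ} {W : (ℕ → E × Bool) → ℝ≥0∞} (hW : Measurable W)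
    (hdep : DependsOn W (Set.Iio n)) {k f : E → ℝ≥0∞} (hk : Measurable k) (hf : Measurable f) :
    ∫⁻ ω, W ω * notRegen (ω n) * k (ω n).1 * f (ω (n + 1)).1 ∂M.splitLaw =
      ∫⁻ ω, W ω * (k (ω n).1 * ∫⁻ y, f y ∂M.H (ω n).1) ∂M.splitLaw := by
  have : Nonempty E := M.nonempty_state
  have hnm : Measurable fun ω : ℕ → E × Bool => notRegen (ω n) :=
    measurable_notRegen.comp (measurable_pi_apply n)
  have hkm : Measurable fun ω : ℕ → E × Bool => k (ω n).1 :=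
    hk.comp (measurable_fst.comp (measurable_pi_apply n))
  have hdep' : DependsOn (fun ω => W ω * notRegen (ω n) * k (ω n).1) (Set.Iic n) := by
    intro x y h
    have h1 : W x = W y := hdep fun i hi => h i (Set.mem_Iic.2 (le_of_lt (Set.mem_Iio.1 hi)))
    simp only [h1, h n (Set.mem_Iic.2 le_rfl)]
  have h1 := lintegral_chainLaw_succ M.splitKernel (M.ν.compProd M.coin)
    ((hW.mul hnm).mul hkm) hdep' (f := fun z => f z.1) (hf.comp measurable_fst)
  simp_rw [M.lintegral_splitKernel _ (f := fun z => f z.1) (hf.comp measurable_fst)] at h1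
  simp only [lintegral_const, measure_univ, mul_one, Pi.mul_apply] at h1
  have h2 := M.lintegral_splitLaw_coin hW hdep
    (f := fun z => notRegen z * k z.1 * ∫⁻ x, f x ∂M.nextState z)
    ((measurable_notRegen.mul (hk.comp measurable_fst)).mul hf.lintegral_kernel)
  unfold splitLaw at h2 ⊢
  simp only [← mul_assoc] at h2
  rw [h1, h2]
  refine lintegral_congr fun ω => ?_
  rw [lintegral_coin, notRegen_true, notRegen_false, ← one_sub_s_mul_lintegral_Q]
  have : M.nextState ((ω n).1, false) = M.Q (ω n).1 := rfl
  rw [this]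
  ring

/-- The indicator that there is no regeneration before time `n`. -/
def alive (n : ℕ) (ω : ℕ → E × Bool) : ℝ≥0∞ := ∏ i ∈ Finset.range n, notRegen (ω i)

theorem measurable_alive (n : ℕ) : Measurable (alive (E := E) n) :=
  Finset.measurable_fun_prod _ fun i _ => measurable_notRegen.comp (measurable_pi_apply i)

theorem dependsOn_alive {E : Type*} {m n : ℕ} (h : m ≤ n) : DependsOn (alive (E := E) m) (Set.Iio n) := by
  intro x y hxy
  refine Finset.prod_congr rfl fun i hi => ?_
  rw [hxy i (Set.mem_Iio.2 ((Finset.mem_range.1 hi).trans_le h))]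

theorem lintegral_alive (n : ℕ) {f : E → ℝ≥0∞} (hf : Measurable f) :
    ∫⁻ ω, alive n ω * f (ω n).1 ∂M.splitLaw = ∫⁻ x, f x ∂M.tabooLaw n := by
  induction n generalizing f with
  | zero =>
    simp only [alive, Finset.range_zero, Finset.prod_empty, one_mul]
    unfold splitLaw
    rw [lintegral_chainLaw_zero _ _ (f := fun z : E × Bool => f z.1) (hf.comp measurable_fst),
      Measure.lintegral_compProd (f := fun z : E × Bool => f z.1) (hf.comp measurable_fst), lintegral_tabooLaw_zero _ hf]
    simp only [lintegral_const, measure_univ, mul_one]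
  | succ n ih =>
    rw [lintegral_tabooLaw_succ _ _ hf, ← ih hf.lintegral_kernel]
    have := M.lintegral_splitLaw_succ (measurable_alive n) (dependsOn_alive le_rfl)
      (k := fun _ => 1) measurable_const hf
    simpa only [one_mul, mul_one, alive, Finset.prod_range_succ] using this

theorem lintegral_alive_pair (t r : ℕ) {f g : E → ℝ≥0∞} (hg : Measurable g) (hf : Measurable f) :
    ∫⁻ ω, alive (t + r) ω * (g (ω t).1 * f (ω (t + r)).1) ∂M.splitLaw =
      ∫⁻ x, g x * ∫⁻ y, f y ∂(M.H ^ r) x ∂M.tabooLaw t := by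
  induction r generalizing f with
  | zero =>
    simp_rw [lintegral_pow_zero _ _ hf]
    exact M.lintegral_alive t (hg.mul hf)
  | succ r ih =>
    simp_rw [lintegral_pow_succ' _ _ _ hf]
    rw [← ih hf.lintegral_kernel]
    -- For `r = 0` the factor `g` sits at the current time and is passed as `k`; afterwards it
    -- belongs to the strict past and is absorbed in `W`.
    rcases r with _ | r
    · have := M.lintegral_splitLaw_succ (measurable_alive t) (dependsOn_alive le_rfl) hg hf
      rw [add_zero, ← this]
      refine lintegral_congr fun ω => ?_
      rw [zero_add, alive, alive, Finset.prod_range_succ]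
      ring
    · have hgm : Measurable fun ω : ℕ → E × Bool => g (ω t).1 :=
        hg.comp (measurable_fst.comp (measurable_pi_apply t))
      have := M.lintegral_splitLaw_succ (n := t + (r + 1))
        (W := fun ω => alive (t + (r + 1)) ω * g (ω t).1)
        ((measurable_alive _).mul hgm) (by
          intro x y h
          have h1 : x t = y t := h t (by simp)
          simp only [dependsOn_alive le_rfl h, h1]) (k := fun _ => 1) measurable_const hf
      simp only [one_mul, mul_one, mul_assoc] at this
      simp only [← add_assoc] at this ⊢
      rw [← this]
      refine lintegral_congr fun ω => ?_
      rw [alive, Finset.prod_range_succ, ← alive]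
      ring

end Split

end AtomicChain

/-- Adding the diagonal once more makes the square twice the sum over pairs `t ≤ t + r`, the
diagonal included. -/
theorem sq_sum_range_add_sum_sq (a : ℕ → ℝ) (n : ℕ) :
    (∑ t ∈ Finset.range n, a t) ^ 2 + ∑ t ∈ Finset.range n, a t ^ 2 =
      2 * ∑ t ∈ Finset.range n, ∑ r ∈ Finset.range (n - t), a t * a (t + r) := by
  induction n with
  | zero => simp
  | succ n ih =>
    have h : ∑ t ∈ Finset.range n, ∑ r ∈ Finset.range (n + 1 - t), a t * a (t + r) =
        ∑ t ∈ Finset.range n, ∑ r ∈ Finset.range (n - t), a t * a (t + r) +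
          (∑ t ∈ Finset.range n, a t) * a n := by
      rw [Finset.sum_mul, ← Finset.sum_add_distrib]
      refine Finset.sum_congr rfl fun t ht => ?_
      have ht := Finset.mem_range.1 ht
      rw [show n + 1 - t = n - t + 1 by omega, Finset.sum_range_succ,
        show t + (n - t) = n by omega]
    rw [Finset.sum_range_succ, Finset.sum_range_succ,
      Finset.sum_range_succ (fun t => ∑ r ∈ Finset.range (n + 1 - t), a t * a (t + r)), h,
      show n + 1 - n = 1 by omega, Finset.sum_range_one, add_zero]
    linear_combination ih

theorem sum_range_add_lt_eq (a : ℕ → ℝ) (n : ℕ) :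
    ∑ q ∈ Finset.range n ×ˢ Finset.range n, (if q.1 + q.2 < n then a q.1 * a (q.1 + q.2) else 0) =
      ∑ t ∈ Finset.range n, ∑ r ∈ Finset.range (n - t), a t * a (t + r) := by
  rw [Finset.sum_product]
  refine Finset.sum_congr rfl fun t ht => ?_
  rw [← Finset.sum_filter]
  refine Finset.sum_congr ?_ fun _ _ => rfl
  ext r
  simp only [Finset.mem_filter, Finset.mem_range]
  omega

namespace AtomicChain

variable {E : Type*} [MeasurableSpace E] (M : AtomicChain E)

/-! ### Moments of the block sum. -/

section BlockSum

/-- The event of no regeneration before time `n`. -/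
def aliveSet (E : Type*) (n : ℕ) : Set (ℕ → E × Bool) := {ω | ∀ i < n, (ω i).2 = false}

theorem alive_eq_indicator {E : Type*} (n : ℕ) : alive (E := E) n = (aliveSet E n).indicator 1 := by
  ext ω
  by_cases h : ω ∈ aliveSet E n
  · rw [Set.indicator_of_mem h]
    refine Finset.prod_eq_one fun i hi => ?_
    rw [notRegen, h i (Finset.mem_range.1 hi)]
    rfl
  · rw [Set.indicator_of_notMem h]
    simp only [aliveSet, Set.mem_ofPred_eq, not_forall] at h
    obtain ⟨i, hi, hi'⟩ := h
    refine Finset.prod_eq_zero (Finset.mem_range.2 hi) ?_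
    rw [notRegen, if_pos (by simpa using hi')]

theorem measurableSet_aliveSet (n : ℕ) : MeasurableSet (aliveSet E n) := by
  have : aliveSet E n = alive n ⁻¹' {1} := by
    ext ω
    rw [alive_eq_indicator]
    by_cases h : ω ∈ aliveSet E n <;> simp [h]
  rw [this]
  exact measurable_alive n (measurableSet_singleton 1)

theorem lintegral_aliveSet (n : ℕ) (F : (ℕ → E × Bool) → ℝ≥0∞) :
    ∫⁻ ω in aliveSet E n, F ω ∂M.splitLaw = ∫⁻ ω, alive n ω * F ω ∂M.splitLaw := by
  rw [← lintegral_indicator (measurableSet_aliveSet n), alive_eq_indicator]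
  refine lintegral_congr fun ω => ?_
  by_cases h : ω ∈ aliveSet E n <;> simp [h]

theorem map_aliveSet (n : ℕ) :
    (M.splitLaw.restrict (aliveSet E n)).map (fun ω => (ω n).1) = M.tabooLaw n := by
  refine Measure.ext_of_lintegral _ fun f hf => ?_
  rw [lintegral_map hf (by fun_prop), lintegral_aliveSet, lintegral_alive _ _ hf]

theorem map_aliveSet_pair (t r : ℕ) :
    (M.splitLaw.restrict (aliveSet E (t + r))).map (fun ω => ((ω t).1, (ω (t + r)).1)) =
      M.tabooLaw t ⊗ₘ (M.H ^ r) := by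
  refine Measure.ext_prod fun {A B} hA hB => ?_
  have hAm : Measurable (A.indicator (1 : E → ℝ≥0∞)) := measurable_one.indicator hA
  have hBm : Measurable (B.indicator (1 : E → ℝ≥0∞)) := measurable_one.indicator hB
  have h := M.lintegral_alive_pair t r hAm hBm
  rw [← lintegral_aliveSet] at h
  rw [Measure.map_apply (by fun_prop) (hA.prod hB), Measure.compProd_apply_prod hA hB,
    ← lintegral_indicator hA, ← lintegral_indicator_one (by
      exact (by fun_prop : Measurable fun ω : ℕ → E × Bool => ((ω t).1, (ω (t + r)).1))
        (hA.prod hB))]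
  refine Eq.trans (lintegral_congr fun ω => ?_) (h.trans (lintegral_congr fun x => ?_))
  · by_cases h1 : (ω t).1 ∈ A <;> by_cases h2 : (ω (t + r)).1 ∈ B <;> simp [Set.indicator, h1, h2]
  · rw [lintegral_indicator_one hB]
    by_cases h1 : x ∈ A <;> simp [h1]

/-- The event that the split chain regenerates. -/
def regenSet (E : Type*) : Set (ℕ → E × Bool) := {ω | ∃ t, (ω t).2 = true}

/-- A path that never regenerates is alive at every `n`, and the probability of being alive at `n`
is the mass of νH^n, which tends to 0. The value of `tau` on such paths therefore plays no role. -/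
theorem ae_regenSet (hν : ∫⁻ x, M.escape x ∂M.ν = 0) : ∀ᵐ ω ∂M.splitLaw, ω ∈ regenSet E := by
  have h : ∀ n, M.splitLaw (regenSet E)ᶜ ≤ M.tabooLaw n Set.univ := by
    intro n
    rw [← map_aliveSet, Measure.map_apply (by fun_prop) MeasurableSet.univ]
    simp only [Set.preimage_univ, Measure.restrict_apply_univ]
    refine measure_mono fun ω hω i _ => ?_
    by_contra hi
    exact hω ⟨i, by simpa using hi⟩
  exact le_antisymm (ge_of_tendsto' (M.tendsto_tabooLaw_univ hν) h) zero_le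

theorem mem_aliveSet_iff {E : Type*} {ω : ℕ → E × Bool} (hω : ω ∈ regenSet E) (n : ℕ) :
    ω ∈ aliveSet E n ↔ n < tau ω + 1 := by
  have hne : {t : ℕ | (ω t).2 = true}.Nonempty := hω
  rw [Nat.lt_succ_iff]
  constructor
  · intro h
    by_contra! hlt
    have h1 : (ω (tau ω)).2 = true := Nat.sInf_mem hne
    rw [h _ hlt] at h1
    exact absurd h1 (by simp)
  · intro h i hi
    have := Nat.notMem_of_lt_sInf (lt_of_lt_of_le hi h)
    simpa using this

theorem hasSum_blockSum {E : Type*} {ω : ℕ → E × Bool} (hω : ω ∈ regenSet E) (g : E → ℝ) :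
    HasSum (fun t => (aliveSet E t).indicator (fun ω => g (ω t).1) ω) (blockSum g ω) := by
  have : blockSum g ω = ∑ t ∈ Finset.range (tau ω + 1),
      (aliveSet E t).indicator (fun ω => g (ω t).1) ω := by
    refine Finset.sum_congr rfl fun t ht => ?_
    rw [Set.indicator_of_mem ((mem_aliveSet_iff hω t).2 (Finset.mem_range.1 ht))]
  rw [this]
  refine hasSum_sum_of_ne_finset_zero fun t ht => ?_
  rw [Finset.mem_range] at ht
  rw [Set.indicator_of_notMem (fun h => ht ((mem_aliveSet_iff hω t).1 h))]

theorem hasSum_blockSum_pair {E : Type*} {ω : ℕ → E × Bool} (hω : ω ∈ regenSet E) (g : E → ℝ) :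
    HasSum (fun q : ℕ × ℕ => (aliveSet E (q.1 + q.2)).indicator
      (fun ω => g (ω q.1).1 * g (ω (q.1 + q.2)).1) ω)
      ((blockSum g ω ^ 2 + blockSum (fun x => g x ^ 2) ω) / 2) := by
  have h1 := sq_sum_range_add_sum_sq (fun t => g (ω t).1) (tau ω + 1)
  rw [← sum_range_add_lt_eq (fun t => g (ω t).1)] at h1
  have h2 : (blockSum g ω ^ 2 + blockSum (fun x => g x ^ 2) ω) / 2 =
      ∑ q ∈ Finset.range (tau ω + 1) ×ˢ Finset.range (tau ω + 1),
        (aliveSet E (q.1 + q.2)).indicator (fun ω => g (ω q.1).1 * g (ω (q.1 + q.2)).1) ω := by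
    unfold blockSum
    rw [h1, mul_div_cancel_left₀ _ two_ne_zero]
    refine Finset.sum_congr rfl fun q _ => ?_
    by_cases h : q.1 + q.2 < tau ω + 1
    · rw [if_pos h, Set.indicator_of_mem ((mem_aliveSet_iff hω _).2 h)]
    · rw [if_neg h, Set.indicator_of_notMem (fun h' => h ((mem_aliveSet_iff hω _).1 h'))]
  rw [h2]
  refine hasSum_sum_of_ne_finset_zero fun q hq => ?_
  refine Set.indicator_of_notMem (fun h => hq ?_) _
  have := (mem_aliveSet_iff hω _).1 h
  rw [Finset.mem_product, Finset.mem_range, Finset.mem_range]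
  omega

theorem aestronglyMeasurable_blockSum (hν : ∫⁻ x, M.escape x ∂M.ν = 0) {g : E → ℝ}
    (hg : Measurable g) :
    AEStronglyMeasurable (blockSum g) M.splitLaw := by
  refine aestronglyMeasurable_of_tendsto_ae atTop
    (f := fun n ω => ∑ t ∈ Finset.range n, (aliveSet E t).indicator (fun ω => g (ω t).1) ω)
    (fun n => ?_) ?_
  · refine (Finset.measurable_fun_sum _ fun t _ => ?_).aestronglyMeasurable
    exact Measurable.indicator (by fun_prop) (measurableSet_aliveSet t)
  · filter_upwards [M.ae_regenSet hν] with ω hω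
    exact (hasSum_blockSum hω g).tendsto_sum_nat

/-- U₀(g) is the sum over all `t` of g(X_t) on {t ≤ τ}, where X_t has law νH^t; these laws add up to
π_s. -/
theorem integral_blockSum (hν : ∫⁻ x, M.escape x ∂M.ν = 0) {g : E → ℝ}
    (hg : Measurable g) (hint : Integrable g M.piS) :
    Integrable (blockSum g) M.splitLaw ∧ ∫ ω, blockSum g ω ∂M.splitLaw = M.mean g := by
  have hm : ∀ t, Measurable fun ω : ℕ → E × Bool => g (ω t).1 := fun t => by fun_prop
  have hl : ∑' t, ∫⁻ ω, ‖(aliveSet E t).indicator (fun ω => g (ω t).1) ω‖ₑ ∂M.splitLaw =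
      ∫⁻ x, ‖g x‖ₑ ∂M.piS := by
    rw [lintegral_piS]
    refine tsum_congr fun t => ?_
    simp_rw [enorm_indicator_eq_indicator_enorm]
    rw [lintegral_indicator (measurableSet_aliveSet t), lintegral_aliveSet,
      M.lintegral_alive t (f := fun x => ‖g x‖ₑ) hg.enorm]
  have hfin : ∑' t, ∫⁻ ω, ‖(aliveSet E t).indicator (fun ω => g (ω t).1) ω‖ₑ ∂M.splitLaw ≠ ∞ := by
    rw [hl]; exact hint.2.ne
  have hae : (fun ω => ∑' t, (aliveSet E t).indicator (fun ω => g (ω t).1) ω)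
      =ᵐ[M.splitLaw] blockSum g := by
    filter_upwards [M.ae_regenSet hν] with ω hω using (hasSum_blockSum hω g).tsum_eq
  constructor
  · refine ⟨M.aestronglyMeasurable_blockSum hν hg, ?_⟩
    refine lt_of_le_of_lt (lintegral_mono_ae (g := fun ω =>
      ∑' t, ‖(aliveSet E t).indicator (fun ω => g (ω t).1) ω‖ₑ) ?_) ?_
    · filter_upwards [hae] with ω hω
      rw [← hω]
      exact enorm_tsum_le_tsum_enorm
    · rw [lintegral_tsum fun t => ((hm t).indicator (measurableSet_aliveSet t)).enorm.aemeasurable]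
      exact hfin.lt_top
  · rw [← integral_congr_ae hae, integral_tsum (fun t =>
      ((hm t).indicator (measurableSet_aliveSet t)).aestronglyMeasurable) hfin, mean]
    have hint' := hint
    rw [piS_eq_sum] at hint'
    rw [piS_eq_sum, integral_sum_measure hint']
    refine tsum_congr fun t => ?_
    rw [integral_indicator (measurableSet_aliveSet t), ← map_aliveSet,
      integral_map (Measurable.aemeasurable (by fun_prop)) hg.aestronglyMeasurable]

theorem piS_compProd_G : M.piS ⊗ₘ M.G =
    Measure.sum fun q : ℕ × ℕ => M.tabooLaw q.1 ⊗ₘ (M.H ^ q.2) := by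
  rw [piS_eq_sum, G, Measure.compProd_sum_left]
  simp_rw [Measure.compProd_sum_right]
  exact Measure.sum_sum _

theorem tsum_lintegral_aliveSet_pair {g : E → ℝ} (hg : Measurable g) :
    ∑' q : ℕ × ℕ, ∫⁻ ω, ‖(aliveSet E (q.1 + q.2)).indicator
      (fun ω => g (ω q.1).1 * g (ω (q.1 + q.2)).1) ω‖ₑ ∂M.splitLaw =
      ∫⁻ x, ‖g x‖ₑ * ∫⁻ y, ‖g y‖ₑ ∂M.G x ∂M.piS := by
  have h : ∀ x, ‖g x‖ₑ * ∫⁻ y, ‖g y‖ₑ ∂M.G x = ∫⁻ y, ‖g x * g y‖ₑ ∂M.G x := by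
    intro x
    simp_rw [enorm_mul]
    rw [lintegral_const_mul _ hg.enorm]
  simp_rw [h]
  rw [← Measure.lintegral_compProd (f := fun q => ‖g q.1 * g q.2‖ₑ) (by fun_prop), piS_compProd_G,
    lintegral_sum_measure]
  refine tsum_congr fun q => ?_
  simp_rw [enorm_indicator_eq_indicator_enorm]
  rw [lintegral_indicator (measurableSet_aliveSet _), ← map_aliveSet_pair,
    lintegral_map (by fun_prop) (by fun_prop)]

/-- The expectation of the pair sum in `hasSum_blockSum_pair` is π_s(g·Gg), by absolute convergence.
Since U₀(g²) has mean π_s(g²), this yields the second moment. -/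
theorem blockVar_eq (hν : ∫⁻ x, M.escape x ∂M.ν = 0) {g : E → ℝ}
    (hg : Measurable g) (hint : Integrable g M.piS)
    (hint2 : Integrable (fun x => g x ^ 2) M.piS)
    (hG : ∫⁻ x, ‖g x‖ₑ * ∫⁻ y, ‖g y‖ₑ ∂M.G x ∂M.piS ≠ ∞) :
    MemLp (blockSum g) 2 M.splitLaw ∧
      M.blockVar g = 2 * ∫ x, g x * ∫ y, g y ∂M.G x ∂M.piS - ∫ x, g x ^ 2 ∂M.piS
        - M.mean g ^ 2 := by
  have hm : ∀ q : ℕ × ℕ, Measurable ((aliveSet E (q.1 + q.2)).indicator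
      fun ω => g (ω q.1).1 * g (ω (q.1 + q.2)).1) :=
    fun q => Measurable.indicator (by fun_prop) (measurableSet_aliveSet _)
  have hfin := hG
  rw [← M.tsum_lintegral_aliveSet_pair hg] at hfin
  have hae : (fun ω => ∑' q : ℕ × ℕ, (aliveSet E (q.1 + q.2)).indicator
      (fun ω => g (ω q.1).1 * g (ω (q.1 + q.2)).1) ω)
      =ᵐ[M.splitLaw] fun ω => (blockSum g ω ^ 2 + blockSum (fun x => g x ^ 2) ω) / 2 := by
    filter_upwards [M.ae_regenSet hν] with ω hω using (hasSum_blockSum_pair hω g).tsum_eq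
  obtain ⟨hi2, he2⟩ := M.integral_blockSum hν (hg.pow_const 2) hint2
  obtain ⟨hi1, he1⟩ := M.integral_blockSum hν hg hint
  have hS : Integrable (fun ω => (blockSum g ω ^ 2 + blockSum (fun x => g x ^ 2) ω) / 2)
      M.splitLaw := by
    refine ⟨?_, ?_⟩
    · simp_rw [div_eq_mul_inv]
      exact ((hi1.1.pow 2).add hi2.1).mul_const _
    refine lt_of_le_of_lt (lintegral_mono_ae (g := fun ω => ∑' q : ℕ × ℕ,
      ‖(aliveSet E (q.1 + q.2)).indicator
        (fun ω => g (ω q.1).1 * g (ω (q.1 + q.2)).1) ω‖ₑ) ?_) ?_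
    · filter_upwards [hae] with ω hω
      rw [← hω]
      exact enorm_tsum_le_tsum_enorm
    · rw [lintegral_tsum fun q => (hm q).enorm.aemeasurable]
      exact hfin.lt_top
  have hsq : Integrable (fun ω => blockSum g ω ^ 2) M.splitLaw := by
    refine ((hS.const_mul 2).sub hi2).congr (Eventually.of_forall fun ω => ?_)
    simp only [Pi.sub_apply]
    ring
  have hL2 : MemLp (blockSum g) 2 M.splitLaw := (memLp_two_iff_integrable_sq hi1.1).2 hsq
  refine ⟨hL2, ?_⟩
  have hGint : Integrable (fun q : E × E => g q.1 * g q.2) (M.piS ⊗ₘ M.G) := by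
    refine ⟨by fun_prop, ?_⟩
    rw [HasFiniteIntegral, Measure.lintegral_compProd (by fun_prop)]
    refine lt_of_eq_of_lt (lintegral_congr fun x => ?_) hG.lt_top
    simp_rw [enorm_mul]
    rw [lintegral_const_mul _ hg.enorm]
  have hI : ∫ ω, (blockSum g ω ^ 2 + blockSum (fun x => g x ^ 2) ω) / 2 ∂M.splitLaw =
      ∫ x, g x * ∫ y, g y ∂M.G x ∂M.piS := by
    rw [← integral_congr_ae hae, integral_tsum (fun q => (hm q).aestronglyMeasurable) hfin]
    have h1 := Measure.integral_compProd hGint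
    simp_rw [integral_const_mul] at h1
    rw [← h1]
    have hGint' := hGint
    rw [piS_compProd_G] at hGint'
    rw [piS_compProd_G, integral_sum_measure hGint']
    refine tsum_congr fun q => ?_
    rw [integral_indicator (measurableSet_aliveSet _), ← map_aliveSet_pair,
      integral_map (by fun_prop) (by fun_prop)]
  rw [integral_div, integral_add hsq hi2, he2] at hI
  rw [blockVar, variance_eq_sub hL2, he1]
  simp only [Pi.pow_apply]
  rw [← hI, mean, mean]
  ring

end BlockSum

end AtomicChain

/-- By symmetry the two tails are copies of one convergent series, so their cutoffs may go to
infinity independently. -/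
theorem hasBilateralSum_of_symm {a : ℤ → ℝ} {T : ℝ} (hsymm : ∀ k : ℕ, a (Int.negSucc k) = a (k + 1))
    (h : Tendsto (fun n : ℕ => ∑ k ∈ Finset.range n, a (k + 1)) atTop (𝓝 T)) :
    HasBilateralSum a (a 0 + 2 * T) := by
  have hsum : ∀ m n : ℕ, ∑ l ∈ Finset.Icc (-(m : ℤ)) n, a l =
      a 0 + ∑ k ∈ Finset.range n, a (k + 1) + ∑ k ∈ Finset.range m, a (k + 1) := by
    intro m n
    induction m with
    | zero =>
      induction n with
      | zero => simp
      | succ n ih =>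
        have e : Finset.Icc (-((0 : ℕ) : ℤ)) ((n + 1 : ℕ) : ℤ) =
            insert ((n : ℤ) + 1) (Finset.Icc (-((0 : ℕ) : ℤ)) (n : ℤ)) := by
          ext i; simp only [Finset.mem_Icc, Finset.mem_insert]; omega
        rw [e, Finset.sum_insert (by simp), ih, Finset.sum_range_succ _ n]
        ring
    | succ m ih =>
      have e : Finset.Icc (-((m + 1 : ℕ) : ℤ)) (n : ℤ) =
          insert (Int.negSucc m) (Finset.Icc (-(m : ℤ)) (n : ℤ)) := by
        ext i; simp only [Finset.mem_Icc, Finset.mem_insert]; omega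
      rw [e, Finset.sum_insert (by simp only [Finset.mem_Icc]; omega), ih,
        Finset.sum_range_succ _ m, hsymm]
      ring
  unfold HasBilateralSum
  simp_rw [hsum]
  rw [two_mul, ← add_assoc]
  rw [← prod_atTop_atTop_eq]
  exact ((h.comp tendsto_snd).const_add (a 0)).add (h.comp tendsto_fst)

namespace AtomicChain

variable {E : Type*} [MeasurableSpace E] (M : AtomicChain E)

theorem integral_bind_kernel {α β : Type*} [MeasurableSpace α] [MeasurableSpace β]
    {μ : Measure α} {κ : Kernel α β} {f : β → ℝ} (hf : Integrable f (μ.bind κ)) :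
    ∫ y, f y ∂(μ.bind κ) = ∫ x, ∫ y, f y ∂κ x ∂μ := by
  rw [Measure.comp_eq_comp_const_apply] at hf ⊢
  rw [Kernel.integral_comp hf, Kernel.const_apply]

/-! ### The laws νP^n as renewal convolutions. -/

section Renewal

/-- The measure `ν P^n`. -/
def lawAt (n : ℕ) : Measure E := M.ν.bind (M.P ^ n : Kernel E E)

instance (n : ℕ) : IsProbabilityMeasure (M.lawAt n) := by unfold lawAt; infer_instance

theorem renewalSeq_le_one (n : ℕ) : M.renewalSeq n ≤ 1 := by
  rcases n with _ | n
  · exact le_rfl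
  · calc _ ≤ ∫⁻ _, 1 ∂M.ν := lintegral_mono fun y => M.lintegral_P_pow_s_le n y
      _ = 1 := by simp

theorem renewalSeq_ne_top (n : ℕ) : M.renewalSeq n ≠ ∞ :=
  ((M.renewalSeq_le_one n).trans_lt ENNReal.one_lt_top).ne

theorem lawAt_eq (n : ℕ) : M.lawAt n =
    ∑ j ∈ Finset.range (n + 1), M.renewalSeq (n - j) • M.tabooLaw j := by
  refine Measure.ext_of_lintegral _ fun f hf => ?_
  rw [lawAt, Measure.lintegral_bind (Kernel.aemeasurable _) hf.aemeasurable,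
    lintegral_nu_P_pow _ _ hf, lintegral_finsetSum_measure]
  simp_rw [lintegral_smul_measure, smul_eq_mul]

theorem integrable_tabooLaw {g : E → ℝ} (hg : Integrable g M.piS) (n : ℕ) :
    Integrable g (M.tabooLaw n) := by
  rw [piS_eq_sum] at hg
  exact hg.mono_measure (Measure.le_sum _ n)

theorem hasSum_integral_tabooLaw {g : E → ℝ} (hg : Integrable g M.piS) :
    HasSum (fun n => ∫ x, g x ∂M.tabooLaw n) (M.mean g) := by
  rw [mean, piS_eq_sum]
  rw [piS_eq_sum] at hg
  exact hasSum_integral_measure hg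

theorem integral_lawAt {g : E → ℝ} (hg : Integrable g M.piS) (n : ℕ) :
    ∫ x, g x ∂M.lawAt n =
      ∑ j ∈ Finset.range (n + 1), (∫ x, g x ∂M.tabooLaw j) * (M.renewalSeq (n - j)).toReal := by
  rw [lawAt_eq, integral_finsetSum_measure fun j _ =>
    (M.integrable_tabooLaw hg j).smul_measure (M.renewalSeq_ne_top _)]
  refine Finset.sum_congr rfl fun j _ => ?_
  rw [integral_smul_measure, smul_eq_mul, mul_comm]

theorem integrable_s (hν : ∫⁻ x, M.escape x ∂M.ν = 0) : Integrable M.s M.piS := by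
  refine ⟨M.measurable_s.aestronglyMeasurable, ?_⟩
  rw [hasFiniteIntegral_iff_ofReal (Eventually.of_forall M.s_nonneg), M.lintegral_piS_s hν]
  exact ENNReal.one_lt_top

theorem mean_s (hν : ∫⁻ x, M.escape x ∂M.ν = 0) : M.mean M.s = 1 := by
  rw [mean, integral_eq_lintegral_of_nonneg_ae (Eventually.of_forall M.s_nonneg)
    M.measurable_s.aestronglyMeasurable, M.lintegral_piS_s hν, ENNReal.toReal_one]

theorem integral_lawAt_s (n : ℕ) : ∫ x, M.s x ∂M.lawAt n = (M.renewalSeq (n + 1)).toReal := by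
  rw [integral_eq_lintegral_of_nonneg_ae (Eventually.of_forall M.s_nonneg)
    M.measurable_s.aestronglyMeasurable, lawAt,
    Measure.lintegral_bind (Kernel.aemeasurable _) M.measurable_ofReal_s.aemeasurable]
  rfl

theorem integral_tabooLaw_s (n : ℕ) :
    ∫ x, M.s x ∂M.tabooLaw n = (∫⁻ x, ENNReal.ofReal (M.s x) ∂M.tabooLaw n).toReal :=
  integral_eq_lintegral_of_nonneg_ae (Eventually.of_forall M.s_nonneg)
    M.measurable_s.aestronglyMeasurable

theorem renewalSeq_sub_tendsto {φ : Measure E} (hs : IsPosFun φ M.s)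
    (hirr : Kernel.IsIrreducible φ M.P) (haper : IsAperiodic M.P)
    (hν : ∫⁻ x, M.escape x ∂M.ν = 0) :
    Tendsto (fun n => (M.renewalSeq (n + 1)).toReal - (M.renewalSeq n).toReal) atTop (𝓝 0) := by
  refine renewal_sub_tendsto (p := fun n => ∫ x, M.s x ∂M.tabooLaw n)
    (u := fun n => (M.renewalSeq n).toReal)
    (fun j => integral_nonneg M.s_nonneg) ?_ (fun d hd => ?_) rfl fun n => ?_
  · have := M.hasSum_integral_tabooLaw (M.integrable_s hν)
    rwa [M.mean_s hν] at this
  · obtain ⟨j, hj, hdj⟩ := M.exists_not_dvd hs hirr haper hd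
    refine ⟨j, ?_, hdj⟩
    rw [integral_tabooLaw_s]
    refine ENNReal.toReal_pos hj ?_
    refine ((lintegral_mono (g := fun _ => 1) fun x => ?_).trans_lt (by simp)).ne
    simpa using M.s_le_one x
  · rw [← integral_lawAt_s, integral_lawAt _ (M.integrable_s hν)]

/-- νP^n g is the convolution of νH^j g, whose sum is μ_g, with the renewal sequence, and νP^n s is
its term of index `n + 1`. Centering by μ_g s thus gives exactly the difference in
`convolution_sub_tendsto`. -/
theorem integral_center_lawAt_tendsto {φ : Measure E} (hs : IsPosFun φ M.s)
    (hirr : Kernel.IsIrreducible φ M.P) (haper : IsAperiodic M.P)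
    (hν : ∫⁻ x, M.escape x ∂M.ν = 0) {g : E → ℝ} (hg : Integrable g M.piS) :
    Tendsto (fun n => ∫ x, M.center g x ∂M.lawAt n) atTop (𝓝 0) := by
  have h := convolution_sub_tendsto (u := fun n => (M.renewalSeq n).toReal)
    (fun n => ⟨ENNReal.toReal_nonneg,
      ENNReal.toReal_le_of_le_ofReal zero_le_one (by simpa using M.renewalSeq_le_one n)⟩)
    (M.renewalSeq_sub_tendsto hs hirr haper hν) (M.hasSum_integral_tabooLaw hg)
  refine h.congr fun n => ?_
  have hint : ∀ {f : E → ℝ}, Integrable f M.piS → Integrable f (M.lawAt n) := by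
    intro f hf
    rw [lawAt_eq]
    exact integrable_finsetSum_measure.2 fun j _ =>
      (M.integrable_tabooLaw hf j).smul_measure (M.renewalSeq_ne_top _)
  unfold center
  rw [integral_sub (hint hg) ((hint (M.integrable_s hν)).mul_const _), integral_mul_const,
    integral_lawAt_s, integral_lawAt _ hg, mul_comm (M.renewalSeq (n + 1)).toReal]

end Renewal

/-! ### Loss of memory for bounded functions. -/

section Bounded

theorem measurable_powApply (n : ℕ) {f : E → ℝ} (hf : Measurable f) :
    Measurable (M.powApply n f) :=
  (hf.stronglyMeasurable.integral_kernel (κ := M.P ^ n)).measurable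

theorem integrable_of_bounded {f : E → ℝ} {C : ℝ} (hf : Measurable f) (hb : ∀ x, |f x| ≤ C)
    (μ : Measure E) [IsFiniteMeasure μ] : Integrable f μ :=
  Integrable.of_bound hf.aestronglyMeasurable C (Eventually.of_forall hb)

theorem abs_integral_le_of_bounded {f : E → ℝ} {C : ℝ} (hb : ∀ x, |f x| ≤ C)
    (μ : Measure E) [IsProbabilityMeasure μ] : |∫ x, f x ∂μ| ≤ C := by
  simpa using norm_integral_le_of_norm_le_const (μ := μ) (f := f) (Eventually.of_forall hb)

theorem abs_powApply_le (n : ℕ) {f : E → ℝ} {C : ℝ} (hb : ∀ x, |f x| ≤ C) (x : E) :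
    |M.powApply n f x| ≤ C := abs_integral_le_of_bounded hb _

theorem powApply_zero {f : E → ℝ} (hf : Measurable f) : M.powApply 0 f = f := by
  ext x
  rw [powApply, pow_zero_eq_id, Kernel.id_apply, integral_dirac' _ _ hf.stronglyMeasurable]

theorem powApply_succ (n : ℕ) {f : E → ℝ} {x : E} (hf : Integrable f ((M.P ^ (n + 1)) x)) :
    M.powApply (n + 1) f x = ∫ y, M.powApply n f y ∂M.P x := by
  unfold powApply
  rw [pow_succ_eq_comp] at hf ⊢
  exact Kernel.integral_comp hf

theorem powApply_succ' (n : ℕ) {f : E → ℝ} {x : E} (hf : Integrable f ((M.P ^ (n + 1)) x)) :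
    M.powApply (n + 1) f x = M.powApply n (fun y => ∫ z, f z ∂M.P y) x := by
  unfold powApply
  rw [pow_succ_eq_comp'] at hf ⊢
  exact Kernel.integral_comp hf

theorem integral_P {f : E → ℝ} {x : E} (h1 : Integrable f (M.H x)) (h2 : Integrable f M.ν) :
    ∫ y, f y ∂M.P x = ∫ y, f y ∂M.H x + M.s x * ∫ y, f y ∂M.ν := by
  rw [P_apply_eq, integral_add_measure h1 (h2.smul_measure ENNReal.ofReal_ne_top),
    integral_smul_measure, ENNReal.toReal_ofReal (M.s_nonneg x), smul_eq_mul]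

theorem integral_lawAt_eq (n : ℕ) {f : E → ℝ} {C : ℝ} (hf : Measurable f) (hb : ∀ x, |f x| ≤ C) :
    ∫ x, f x ∂M.lawAt n = ∫ x, M.powApply n f x ∂M.ν :=
  integral_bind_kernel (integrable_of_bounded hf hb (M.lawAt n))

/-- If `F` is bounded and `ν P^n (F - P F) → 0` then `P^n F - ν P^n F` tends to zero at the points
from which regeneration is certain. -/
theorem powApply_sub_tendsto {F : E → ℝ} {C : ℝ} (hF : Measurable F) (hb : ∀ x, |F x| ≤ C)
    (hc : Tendsto (fun n => ∫ x, F x ∂M.lawAt n - ∫ x, F x ∂M.lawAt (n + 1)) atTop (𝓝 0))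
    {x : E} (hx : M.escape x = 0) :
    Tendsto (fun n => M.powApply n F x - ∫ x, F x ∂M.lawAt n) atTop (𝓝 0) := by
  set c : ℕ → ℝ := fun n => ∫ x, F x ∂M.lawAt n with hcdef
  set D : ℕ → E → ℝ := fun n x => M.powApply n F x - c n with hD
  have hbc : ∀ n, |c n| ≤ C := fun n => abs_integral_le_of_bounded hb _
  have hDb : ∀ n x, |D n x| ≤ 2 * C := by
    intro n x
    have h1 := abs_sub (M.powApply n F x) (c n)
    have h2 := M.abs_powApply_le n hb x
    have h3 := hbc n
    simp only [hD]; linarith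
  have hDm : ∀ n, Measurable (D n) := fun n => (M.measurable_powApply n hF).sub_const _
  -- `D n` has ν-integral zero, so P and H act on it alike: the recursion is driven by H and
  -- perturbed only by the increments of `c`.
  have hDstep : ∀ n x, D (n + 1) x = ∫ y, D n y ∂M.H x + (c n - c (n + 1)) := by
    intro n x
    have h1 : ∫ y, D n y ∂M.P x = M.powApply (n + 1) F x - c n := by
      simp only [hD]
      rw [integral_sub (integrable_of_bounded (M.measurable_powApply n hF)
        (M.abs_powApply_le n hb) _) (integrable_const _),
        M.powApply_succ n (integrable_of_bounded hF hb _)]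
      simp
    have h2 : ∫ y, D n y ∂M.ν = 0 := by
      simp only [hD]
      rw [integral_sub (integrable_of_bounded (M.measurable_powApply n hF)
        (M.abs_powApply_le n hb) _) (integrable_const _), hcdef]
      simp [M.integral_lawAt_eq n hF hb]
    have h3 := M.integral_P (integrable_of_bounded (hDm n) (hDb n) (M.H x))
      (integrable_of_bounded (hDm n) (hDb n) M.ν)
    rw [h1, h2, mul_zero, add_zero] at h3
    rw [← h3]
    simp only [hD]; ring
  have hiter : ∀ m n x, ‖D (n + m) x‖ₑ ≤ ENNReal.ofReal (2 * C) * (M.H ^ m) x Set.univ +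
      ∑ i ∈ Finset.range m, ‖c (n + i) - c (n + i + 1)‖ₑ := by
    intro m n
    induction m with
    | zero =>
      intro x
      rw [pow_zero_eq_id, measure_univ, mul_one, Finset.range_zero, Finset.sum_empty, add_zero,
        add_zero, ← ofReal_norm]
      exact ENNReal.ofReal_le_ofReal (hDb _ _)
    | succ m ih =>
      intro x
      rw [← add_assoc, hDstep, H_pow_univ_succ, Finset.sum_range_succ, ← add_assoc]
      refine (enorm_add_le _ _).trans ?_
      gcongr
      refine (enorm_integral_le_lintegral_enorm _).trans ((lintegral_mono fun y => ih y).trans ?_)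
      rw [lintegral_add_right _ measurable_const,
        lintegral_const_mul _ (Kernel.measurable_coe _ MeasurableSet.univ), lintegral_const]
      gcongr
      exact mul_le_of_le_one_right zero_le ((M.H_le_P x Set.univ).trans prob_le_one)
  rw [tendsto_zero_iff_enorm_tendsto_zero, ENNReal.tendsto_nhds_zero]
  intro ε hε
  have h1 : Tendsto (fun m => ENNReal.ofReal (2 * C) * (M.H ^ m) x Set.univ) atTop (𝓝 0) := by
    have := ENNReal.Tendsto.const_mul (M.tendsto_escape x)
      (Or.inr (ENNReal.ofReal_ne_top (r := 2 * C)))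
    rwa [hx, mul_zero] at this
  have hε2 : 0 < ε / 2 := ENNReal.half_pos hε.ne'
  -- First `m` is fixed so that the surviving H-mass at `x` is negligible; then `n` is taken large
  -- to make the finitely many increments small.
  obtain ⟨m, hm⟩ := (ENNReal.tendsto_nhds_zero.1 h1 _ hε2).exists
  have h2 : Tendsto (fun n => ∑ i ∈ Finset.range m, ‖c (n + i) - c (n + i + 1)‖ₑ) atTop (𝓝 0) := by
    have : ∀ i ∈ Finset.range m,
        Tendsto (fun n => ‖c (n + i) - c (n + i + 1)‖ₑ) atTop (𝓝 0) := fun i _ =>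
      (tendsto_zero_iff_enorm_tendsto_zero.1 hc).comp (tendsto_add_atTop_nat i)
    simpa using tendsto_finsetSum _ this
  have h3 := (tendsto_sub_atTop_nat m).eventually (ENNReal.tendsto_nhds_zero.1 h2 _ hε2)
  filter_upwards [h3, eventually_ge_atTop m] with n hn hmn
  have := hiter m (n - m) x
  rw [Nat.sub_add_cancel hmn] at this
  calc _ ≤ _ := this
    _ ≤ ε / 2 + ε / 2 := add_le_add hm hn
    _ = ε := ENNReal.add_halves ε

end Bounded

end AtomicChain

namespace AtomicChain

variable {E : Type*} [MeasurableSpace E] (M : AtomicChain E)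

/-! ### Poisson's equation and telescoping of the autocovariances. -/

section BoundedPotential

/-- The potential `G g`. -/
def potential (g : E → ℝ) (x : E) : ℝ := ∫ y, g y ∂M.G x

theorem measurable_potential {g : E → ℝ} (hg : Measurable g) : Measurable (M.potential g) :=
  (hg.stronglyMeasurable.integral_kernel (κ := M.G)).measurable

theorem integrable_G {g : E → ℝ} {C : ℝ≥0∞} (hC : C ≠ ∞) (hg : Measurable g)
    (hb : ∀ x, ∫⁻ y, ‖g y‖ₑ ∂M.G x ≤ C) (x : E) : Integrable g (M.G x) :=
  ⟨hg.aestronglyMeasurable, (hb x).trans_lt hC.lt_top⟩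

theorem abs_potential_le {g : E → ℝ} {C : ℝ≥0∞} (hC : C ≠ ∞)
    (hb : ∀ x, ∫⁻ y, ‖g y‖ₑ ∂M.G x ≤ C) (x : E) : |M.potential g x| ≤ C.toReal := by
  rw [← Real.norm_eq_abs, ← toReal_enorm]
  exact ENNReal.toReal_mono hC ((enorm_integral_le_lintegral_enorm _).trans (hb x))

theorem abs_le_of_lintegral_G_le {g : E → ℝ} {C : ℝ≥0∞} (hC : C ≠ ∞) (hg : Measurable g)
    (hb : ∀ x, ∫⁻ y, ‖g y‖ₑ ∂M.G x ≤ C) (x : E) : |g x| ≤ C.toReal := by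
  rw [← Real.norm_eq_abs, ← toReal_enorm]
  exact ENNReal.toReal_mono hC ((M.le_lintegral_G x hg.enorm).trans (hb x))

theorem integrable_piS_of_lintegral_G_le {g : E → ℝ} {C : ℝ≥0∞} (hC : C ≠ ∞) (hg : Measurable g)
    (hb : ∀ x, ∫⁻ y, ‖g y‖ₑ ∂M.G x ≤ C) : Integrable g M.piS := by
  refine ⟨hg.aestronglyMeasurable, ?_⟩
  rw [HasFiniteIntegral, lintegral_piS' _ hg.enorm]
  calc _ ≤ ∫⁻ _, C ∂M.ν := lintegral_mono hb
    _ = C := by simp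
    _ < ∞ := hC.lt_top

theorem integral_potential_nu {g : E → ℝ} (hg : Integrable g M.piS) :
    ∫ x, M.potential g x ∂M.ν = M.mean g :=
  (integral_bind_kernel hg).symm

/-- Poisson's equation for a bounded potential. -/
theorem potential_sub_P {g : E → ℝ} {C : ℝ≥0∞} (hC : C ≠ ∞) (hg : Measurable g)
    (hb : ∀ x, ∫⁻ y, ‖g y‖ₑ ∂M.G x ≤ C) (x : E) :
    M.potential g x - ∫ y, M.potential g y ∂M.P x = M.center g x := by
  have hFm := M.measurable_potential hg
  have hFb := M.abs_potential_le hC hb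
  have hint := M.integrable_G hC hg hb x
  have h1 : M.potential g x = g x + ∫ y, M.potential g y ∂M.H x := by
    rw [G_eq, _root_.add_apply] at hint
    have hint' := hint.mono_measure (Measure.le_add_left le_rfl : (M.G ∘ₖ M.H) x ≤ _)
    have hint'' := hint.mono_measure (Measure.le_add_right le_rfl : (Kernel.id : Kernel E E) x ≤ _)
    conv_lhs => rw [potential, G_eq]
    rw [_root_.add_apply, integral_add_measure hint'' hint', Kernel.integral_comp hint',
      Kernel.id_apply, integral_dirac' _ _ hg.stronglyMeasurable]
    rfl
  rw [M.integral_P (integrable_of_bounded hFm hFb _) (integrable_of_bounded hFm hFb _),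
    M.integral_potential_nu (M.integrable_piS_of_lintegral_G_le hC hg hb), center]
  linarith

theorem integrable_mul_of_bounded {g h : E → ℝ} {C : ℝ} {μ : Measure E} (hg : Integrable g μ)
    (hh : Measurable h) (hb : ∀ x, |h x| ≤ C) : Integrable (fun x => g x * h x) μ :=
  hg.mul_bdd (c := C) hh.aestronglyMeasurable (Eventually.of_forall hb)

theorem measurable_P_integral {h : E → ℝ} (hh : Measurable h) :
    Measurable fun x => ∫ y, h y ∂M.P x :=
  (hh.stronglyMeasurable.integral_kernel (κ := M.P)).measurable

theorem phi_sub {g h k : E → ℝ} {C : ℝ} (hg : Integrable g M.piS) (hh : Measurable h)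
    (hhb : ∀ x, |h x| ≤ C) (hk : Measurable k) (hkb : ∀ x, |k x| ≤ C) :
    M.phi g (fun x => h x - k x) = M.phi g h - M.phi g k := by
  have e : ∀ x, ∫ y, (h y - k y) ∂M.P x = ∫ y, h y ∂M.P x - ∫ y, k y ∂M.P x := fun x =>
    integral_sub (integrable_of_bounded hh hhb _) (integrable_of_bounded hk hkb _)
  unfold phi
  simp_rw [e, mul_sub]
  rw [integral_sub (integrable_mul_of_bounded hg (M.measurable_P_integral hh)
      fun x => abs_integral_le_of_bounded hhb (M.P x))
    (integrable_mul_of_bounded hg (M.measurable_P_integral hk)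
      fun x => abs_integral_le_of_bounded hkb (M.P x)),
    integral_sub (integrable_of_bounded hh hhb _) (integrable_of_bounded hk hkb _)]
  ring

/-- The functional equals π_s(g·(P^{n+1}F - νP^n F)). The bracket is bounded and tends to 0 wherever
the escape probability vanishes, hence π_s-a.e. -/
theorem phi_powApply_tendsto (hν : ∫⁻ x, M.escape x ∂M.ν = 0) {g F : E → ℝ} {C : ℝ}
    (hg : Integrable g M.piS) (hF : Measurable F) (hb : ∀ x, |F x| ≤ C)
    (hc : Tendsto (fun n => ∫ x, F x ∂M.lawAt n - ∫ x, F x ∂M.lawAt (n + 1)) atTop (𝓝 0)) :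
    Tendsto (fun n => M.phi g (M.powApply n F)) atTop (𝓝 0) := by
  have hphi : ∀ n, M.phi g (M.powApply n F) =
      ∫ x, g x * (M.powApply (n + 1) F x - ∫ x, F x ∂M.lawAt n) ∂M.piS := by
    intro n
    simp_rw [mul_sub]
    rw [integral_sub (integrable_mul_of_bounded hg (M.measurable_powApply _ hF)
      (M.abs_powApply_le _ hb)) (hg.mul_const _), integral_mul_const, phi,
      M.integral_lawAt_eq n hF hb]
    simp_rw [M.powApply_succ n (integrable_of_bounded hF hb _)]
    rfl
  simp_rw [hphi]
  have h0 : ∫ _, (0 : ℝ) ∂M.piS = 0 := integral_zero _ _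
  rw [← h0]
  refine tendsto_integral_of_dominated_convergence (fun x => |g x| * (2 * C)) (fun n => ?_)
    (hg.abs.mul_const _) (fun n => Eventually.of_forall fun x => ?_) ?_
  · exact hg.1.mul ((M.measurable_powApply _ hF).sub_const _).aestronglyMeasurable
  · rw [norm_mul, Real.norm_eq_abs, Real.norm_eq_abs]
    gcongr
    have h1 := abs_sub (M.powApply (n + 1) F x) (∫ x, F x ∂M.lawAt n)
    have h2 := M.abs_powApply_le (n + 1) hb x
    have h3 := abs_integral_le_of_bounded hb (M.lawAt n)
    linarith
  · filter_upwards [M.ae_escape_eq_zero hν] with x hx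
    have h1 := ((M.powApply_sub_tendsto hF hb hc hx).comp (tendsto_add_atTop_nat 1)).sub hc
    have h2 := h1.const_mul (g x)
    rw [sub_zero, mul_zero] at h2
    refine h2.congr fun n => ?_
    simp only [Function.comp]
    ring

/-- The block variance of a function with bounded absolute potential. -/
theorem hasBilateralSum_autoCov {φ : Measure E} (hs : IsPosFun φ M.s)
    (hirr : Kernel.IsIrreducible φ M.P) (haper : IsAperiodic M.P)
    (hν : ∫⁻ x, M.escape x ∂M.ν = 0) {g : E → ℝ} {C : ℝ≥0∞} (hC : C ≠ ∞) (hg : Measurable g)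
    (hb : ∀ x, ∫⁻ y, ‖g y‖ₑ ∂M.G x ≤ C) :
    MemLp (blockSum g) 2 M.splitLaw ∧ HasBilateralSum (M.autoCov g) (M.blockVar g) := by
  set F := M.potential g with hFdef
  have hFm : Measurable F := M.measurable_potential hg
  have hFb : ∀ x, |F x| ≤ C.toReal := M.abs_potential_le hC hb
  have hgb := M.abs_le_of_lintegral_G_le hC hg hb
  have hint := M.integrable_piS_of_lintegral_G_le hC hg hb
  have hint2 : Integrable (fun x => g x ^ 2) M.piS := by
    simp_rw [sq]
    exact integrable_mul_of_bounded hint hg hgb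
  have hG : ∫⁻ x, ‖g x‖ₑ * ∫⁻ y, ‖g y‖ₑ ∂M.G x ∂M.piS ≠ ∞ := by
    refine ((lintegral_mono fun x => mul_le_mul_right (hb x) _).trans_lt ?_).ne
    rw [lintegral_mul_const _ hg.enorm]
    exact ENNReal.mul_lt_top hint.2 hC.lt_top
  obtain ⟨hL2, hvar⟩ := M.blockVar_eq hν hg hint hint2 hG
  refine ⟨hL2, ?_⟩
  have hpoisson := M.potential_sub_P hC hg hb
  have hPFm := M.measurable_P_integral hFm
  have hPFb : ∀ x, |∫ y, F y ∂M.P x| ≤ C.toReal := fun x => abs_integral_le_of_bounded hFb _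
  have hcenter : M.center g = fun x => F x - ∫ y, F y ∂M.P x := by
    ext x; exact (hpoisson x).symm
  have hpow : ∀ k, M.powApply k (M.center g) =
      fun x => M.powApply k F x - M.powApply (k + 1) F x := by
    intro k
    ext x
    rw [M.powApply_succ' k (integrable_of_bounded hFm hFb _), hcenter]
    exact integral_sub (integrable_of_bounded hFm hFb _) (integrable_of_bounded hPFm hPFb _)
  -- By Poisson's equation this difference is νP^n g₀.
  have hc : Tendsto (fun n => ∫ x, F x ∂M.lawAt n - ∫ x, F x ∂M.lawAt (n + 1)) atTop (𝓝 0) := by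
    refine (M.integral_center_lawAt_tendsto hs hirr haper hν hint).congr fun n => ?_
    rw [hcenter, integral_sub (integrable_of_bounded hFm hFb _) (integrable_of_bounded hPFm hPFb _),
      M.integral_lawAt_eq n hPFm hPFb, M.integral_lawAt_eq (n + 1) hFm hFb]
    congr 1
    refine integral_congr_ae (Eventually.of_forall fun x => ?_)
    exact (M.powApply_succ' n (integrable_of_bounded hFm hFb _)).symm
  have hauto : ∀ k : ℕ, M.autoCov g (k + 1) =
      M.phi g (M.powApply k F) - M.phi g (M.powApply (k + 1) F) := by
    intro k
    change M.phi g (M.powApply k (M.center g)) = _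
    rw [hpow, M.phi_sub hint (M.measurable_powApply _ hFm) (M.abs_powApply_le _ hFb)
      (M.measurable_powApply _ hFm) (M.abs_powApply_le _ hFb)]
  have hlim : Tendsto (fun n : ℕ => ∑ k ∈ Finset.range n, M.autoCov g (k + 1)) atTop
      (𝓝 (M.phi g F)) := by
    have h1 := (M.phi_powApply_tendsto hν hint hFm hFb hc).const_sub (M.phi g F)
    rw [sub_zero] at h1
    refine h1.congr fun n => ?_
    simp_rw [hauto]
    rw [Finset.sum_range_sub', M.powApply_zero hFm]
  have hbil := hasBilateralSum_of_symm (a := M.autoCov g) (fun _ => rfl) hlim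
  have hsint := M.integrable_s hν
  have hsb : ∀ x, |M.s x| ≤ 1 := fun x => by
    rw [abs_of_nonneg (M.s_nonneg x)]; exact M.s_le_one x
  have hgs : Integrable (fun x => g x * M.s x) M.piS :=
    integrable_mul_of_bounded hint M.measurable_s hsb
  have hss : Integrable (fun x => M.s x ^ 2) M.piS := by
    simp_rw [sq]
    exact integrable_mul_of_bounded hsint M.measurable_s hsb
  have hgF : Integrable (fun x => g x * F x) M.piS := integrable_mul_of_bounded hint hFm hFb
  have h0 : M.autoCov g 0 = ∫ x, g x ^ 2 ∂M.piS - 2 * M.mean g * ∫ x, g x * M.s x ∂M.piS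
      + M.mean g ^ 2 := by
    change (∫ x, M.center g x * M.center g x ∂M.piS) +
      M.mean g * M.mean g * (1 - ∫ x, M.s x ^ 2 ∂M.piS) = _
    have e : ∀ x, M.center g x * M.center g x =
        g x ^ 2 - 2 * M.mean g * (g x * M.s x) + M.mean g ^ 2 * M.s x ^ 2 := by
      intro x; rw [center]; ring
    simp_rw [e]
    have hA : Integrable (fun x => g x ^ 2 - 2 * M.mean g * (g x * M.s x)) M.piS :=
      hint2.sub (hgs.const_mul _)
    rw [integral_add hA (hss.const_mul _),
      integral_sub hint2 (hgs.const_mul _), integral_const_mul, integral_const_mul]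
    ring
  have hphiF : M.phi g F = ∫ x, g x * F x ∂M.piS - ∫ x, g x ^ 2 ∂M.piS
      + M.mean g * ∫ x, g x * M.s x ∂M.piS - M.mean g ^ 2 := by
    have e : ∀ x, g x * ∫ y, F y ∂M.P x = g x * F x - g x ^ 2 + M.mean g * (g x * M.s x) := by
      intro x
      have := hpoisson x
      rw [center] at this
      have h : ∫ y, F y ∂M.P x = F x - g x + M.s x * M.mean g := by linarith
      rw [h]; ring
    rw [phi]
    simp_rw [e]
    have hA : Integrable (fun x => g x * F x - g x ^ 2) M.piS := hgF.sub hint2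
    rw [integral_add hA (hgs.const_mul _), integral_sub hgF hint2,
      integral_const_mul, hFdef, M.integral_potential_nu hint]
    ring
  -- Doubling φ_g(F) cancels the terms π_s(gs) in γ_g(0) and leaves 2π_s(gF) - π_s(g²) - μ_g².
  have : M.blockVar g = M.autoCov g 0 + 2 * M.phi g F := by
    rw [hvar, h0, hphiF]
    change 2 * ∫ x, g x * F x ∂M.piS - _ - _ = _
    ring
  rw [this]
  exact hbil

end BoundedPotential

end AtomicChain

namespace AtomicChain

variable {E : Type*} [MeasurableSpace E] (M : AtomicChain E)

/-! ### Dominated approximation of covariances and block variances. -/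

section Approximation

theorem sq_integrable_s (hν : ∫⁻ x, M.escape x ∂M.ν = 0) :
    Integrable (fun x => M.s x ^ 2) M.piS := by
  simp_rw [sq]
  refine integrable_mul_of_bounded (M.integrable_s hν) M.measurable_s (C := 1) fun x => ?_
  rw [abs_of_nonneg (M.s_nonneg x)]
  exact M.s_le_one x

theorem measurable_center {g : E → ℝ} (hg : Measurable g) : Measurable (M.center g) :=
  hg.sub (M.measurable_s.mul_const _)

theorem memLp_center (hν : ∫⁻ x, M.escape x ∂M.ν = 0) {g : E → ℝ} (hg : MemLp g 2 M.piS) :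
    MemLp (M.center g) 2 M.piS :=
  hg.sub (((memLp_two_iff_integrable_sq M.measurable_s.aestronglyMeasurable).2
    (M.sq_integrable_s hν)).mul_const _)

theorem integrable_center (hν : ∫⁻ x, M.escape x ∂M.ν = 0) {g : E → ℝ}
    (hg : Integrable g M.piS) : Integrable (M.center g) M.piS :=
  hg.sub ((M.integrable_s hν).mul_const _)

/-- ν ≤ π_s, and π_s is invariant under P^n. -/
theorem lawAt_le_piS (hν : ∫⁻ x, M.escape x ∂M.ν = 0) (n : ℕ) : M.lawAt n ≤ M.piS := by
  refine Measure.le_iff.2 fun A hA => ?_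
  conv_rhs => rw [← M.piS_bind_P_pow hν n]
  rw [lawAt, Measure.bind_apply hA (Kernel.aemeasurable _),
    Measure.bind_apply hA (Kernel.aemeasurable _)]
  exact lintegral_mono' M.nu_le_piS le_rfl

theorem map_fst_compProd_pow (n : ℕ) : (M.piS ⊗ₘ (M.P ^ n)).map Prod.fst = M.piS :=
  Measure.fst_compProd _ _

theorem map_snd_compProd_pow (hν : ∫⁻ x, M.escape x ∂M.ν = 0) (n : ℕ) :
    (M.piS ⊗ₘ (M.P ^ n)).map Prod.snd = M.piS :=
  (Measure.snd_compProd _ _).trans (M.piS_bind_P_pow hν n)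

theorem integrable_comp_fst {f : E → ℝ} (hf : Integrable f M.piS) (n : ℕ) :
    Integrable (fun q : E × E => f q.1) (M.piS ⊗ₘ (M.P ^ n)) := by
  rw [← M.map_fst_compProd_pow n] at hf
  exact hf.comp_measurable measurable_fst

theorem integrable_comp_snd (hν : ∫⁻ x, M.escape x ∂M.ν = 0) {f : E → ℝ}
    (hf : Integrable f M.piS) (n : ℕ) :
    Integrable (fun q : E × E => f q.2) (M.piS ⊗ₘ (M.P ^ n)) := by
  rw [← M.map_snd_compProd_pow hν n] at hf
  exact hf.comp_measurable measurable_snd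

theorem integrable_mul_compProd (hν : ∫⁻ x, M.escape x ∂M.ν = 0) {f h : E → ℝ}
    (hfm : Measurable f) (hhm : Measurable h) (hf : MemLp f 2 M.piS) (hh : MemLp h 2 M.piS)
    (n : ℕ) : Integrable (fun q : E × E => f q.1 * h q.2) (M.piS ⊗ₘ (M.P ^ n)) := by
  refine ((M.integrable_comp_fst hf.integrable_sq n).add
    (M.integrable_comp_snd hν hh.integrable_sq n)).mono' (by fun_prop)
    (Eventually.of_forall fun q => ?_)
  rw [Real.norm_eq_abs, abs_le]
  simp only [Pi.add_apply]
  constructor <;> nlinarith [sq_nonneg (f q.1 + h q.2), sq_nonneg (f q.1 - h q.2)]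

/-- Both marginals of π_s ⊗ P^{k+1} are π_s, so in this form π_s-a.e. statements and L² bounds apply
to each factor. -/
theorem autoCov_succ (hν : ∫⁻ x, M.escape x ∂M.ν = 0) {g : E → ℝ} (hg : Measurable g)
    (h1 : Integrable g M.piS) (h2 : MemLp g 2 M.piS) (k : ℕ) :
    M.autoCov g (k + 1) = ∫ q, g q.1 * M.center g q.2 ∂(M.piS ⊗ₘ (M.P ^ (k + 1))) -
      M.mean g * ∫ x, M.center g x ∂M.lawAt k := by
  have hc := M.integrable_center hν h1
  change (∫ x, g x * (∫ y, M.powApply k (M.center g) y ∂(M.P x)) ∂M.piS) -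
    M.mean g * ∫ y, M.powApply k (M.center g) y ∂M.ν = _
  have hν' : ∫ x, M.center g x ∂M.lawAt k = ∫ y, M.powApply k (M.center g) y ∂M.ν :=
    integral_bind_kernel (hc.mono_measure (M.lawAt_le_piS hν k))
  rw [hν', Measure.integral_compProd
    (M.integrable_mul_compProd hν hg (M.measurable_center hg) h2 (M.memLp_center hν h2) _)]
  congr 1
  have hc' := hc
  rw [← M.piS_bind_P_pow hν (k + 1)] at hc'
  refine integral_congr_ae ?_
  filter_upwards [Measure.ae_integrable_of_integrable_comp hc'] with x hx
  rw [integral_const_mul, ← M.powApply_succ k hx]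
  rfl

theorem autoCov_zero (g : E → ℝ) : M.autoCov g 0 = (∫ x, M.center g x ^ 2 ∂M.piS) +
    M.mean g ^ 2 * (1 - ∫ x, M.s x ^ 2 ∂M.piS) := by
  have h : M.autoCov g 0 = (∫ x, M.center g x * M.center g x ∂M.piS) +
      M.mean g * M.mean g * (1 - ∫ x, M.s x ^ 2 ∂M.piS) := rfl
  simp only [h, sq]

/-- Each law νH^t of X_t on {t ≤ τ} is dominated by π_s, so a block almost surely avoids a π_s-null
set. -/
theorem ae_splitLaw_of_ae_piS (hν : ∫⁻ x, M.escape x ∂M.ν = 0) {p : E → Prop}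
    (hp : ∀ᵐ x ∂M.piS, p x) :
    ∀ᵐ ω ∂M.splitLaw, ∀ t ∈ Finset.range (tau ω + 1), p (ω t).1 := by
  have h : ∀ᵐ ω ∂M.splitLaw, ∀ t, ω ∈ aliveSet E t → p (ω t).1 := by
    refine ae_all_iff.2 fun t => ?_
    rw [← ae_restrict_iff' (measurableSet_aliveSet t)]
    refine ae_of_ae_map (f := fun ω : ℕ → E × Bool => (ω t).1)
      (Measurable.aemeasurable (by fun_prop)) ?_
    rw [map_aliveSet]
    rw [piS_eq_sum] at hp
    exact ae_mono (Measure.le_sum _ t) hp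
  filter_upwards [h, M.ae_regenSet hν] with ω hω hr t ht
  exact hω t ((mem_aliveSet_iff hr t).2 (Finset.mem_range.1 ht))

/-- G|g| = |g| + HG|g| and H ≤ P: square integrability pays for the diagonal term. -/
theorem lintegral_mul_G_ne_top {g : E → ℝ} (hg : Measurable g) (h2 : MemLp g 2 M.piS)
    (hG : ∫⁻ x, ‖g x‖ₑ * (∫⁻ y, (∫⁻ z, ‖g z‖ₑ ∂(M.G y)) ∂(M.P x)) ∂M.piS < ∞) :
    ∫⁻ x, ‖g x‖ₑ * ∫⁻ y, ‖g y‖ₑ ∂M.G x ∂M.piS ≠ ∞ := by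
  have hsq := h2.integrable_sq.2
  refine ((lintegral_mono (g := fun x => ‖g x ^ 2‖ₑ +
    ‖g x‖ₑ * (∫⁻ y, (∫⁻ z, ‖g z‖ₑ ∂(M.G y)) ∂(M.P x))) fun x => ?_).trans_lt ?_).ne
  · simp only [sq (g x), enorm_mul]
    rw [M.lintegral_G_eq x hg.enorm, mul_add]
    gcongr
    exact M.H_le_P x
  · rw [lintegral_add_left (by fun_prop)]
    exact ENNReal.add_lt_top.2 ⟨hsq, hG⟩

variable {g : E → ℝ} {gn : ℕ → E → ℝ}

theorem tendsto_mean (h1 : Integrable g M.piS) (hgn : ∀ n, Measurable (gn n))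
    (hle : ∀ n, ∀ᵐ x ∂M.piS, |gn n x| ≤ |g x|)
    (hlim : ∀ᵐ x ∂M.piS, Tendsto (fun n => gn n x) atTop (𝓝 (g x))) :
    Tendsto (fun n => M.mean (gn n)) atTop (𝓝 (M.mean g)) :=
  tendsto_integral_of_dominated_convergence (fun x => |g x|)
    (fun n => (hgn n).aestronglyMeasurable) h1.abs hle hlim

theorem tendsto_autoCov (hν : ∫⁻ x, M.escape x ∂M.ν = 0) (hg : Measurable g)
    (h1 : Integrable g M.piS) (h2 : MemLp g 2 M.piS) (hgn : ∀ n, Measurable (gn n))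
    (hle : ∀ n, ∀ᵐ x ∂M.piS, |gn n x| ≤ |g x|)
    (hlim : ∀ᵐ x ∂M.piS, Tendsto (fun n => gn n x) atTop (𝓝 (g x))) (l : ℤ) :
    Tendsto (fun n => M.autoCov (gn n) l) atTop (𝓝 (M.autoCov g l)) := by
  have hmean := M.tendsto_mean h1 hgn hle hlim
  -- One majorant for all centered approximants, since |μ_{g_n}| ≤ π_s|g|. It lies in L¹ and L² of
  -- π_s.
  set B : E → ℝ := fun x => |g x| + M.s x * ∫ x, |g x| ∂M.piS with hB
  have hBm : Measurable B := hg.abs.add (M.measurable_s.mul_const _)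
  have hB1 : Integrable B M.piS := h1.abs.add ((M.integrable_s hν).mul_const _)
  have hB2 : MemLp B 2 M.piS := h2.abs.add
    (((memLp_two_iff_integrable_sq M.measurable_s.aestronglyMeasurable).2
      (M.sq_integrable_s hν)).mul_const _)
  have hn1 : ∀ n, Integrable (gn n) M.piS := fun n =>
    h1.mono (hgn n).aestronglyMeasurable (hle n)
  have hn2 : ∀ n, MemLp (gn n) 2 M.piS := fun n =>
    h2.mono (hgn n).aestronglyMeasurable (hle n)
  have hcB : ∀ n, ∀ᵐ x ∂M.piS, |M.center (gn n) x| ≤ B x := by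
    intro n
    have hm : |M.mean (gn n)| ≤ ∫ x, |g x| ∂M.piS :=
      (abs_integral_le_integral_abs).trans (integral_mono_ae (hn1 n).abs h1.abs (hle n))
    filter_upwards [hle n] with x hx
    have h3 := abs_sub (gn n x) (M.s x * M.mean (gn n))
    rw [abs_mul, abs_of_nonneg (M.s_nonneg x)] at h3
    have h4 := mul_le_mul_of_nonneg_left hm (M.s_nonneg x)
    simp only [center, hB]
    linarith
  have hclim : ∀ᵐ x ∂M.piS, Tendsto (fun n => M.center (gn n) x) atTop (𝓝 (M.center g x)) := by
    filter_upwards [hlim] with x hx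
    exact hx.sub (hmean.const_mul _)
  have hsucc : ∀ k : ℕ,
      Tendsto (fun n => M.autoCov (gn n) (k + 1)) atTop (𝓝 (M.autoCov g (k + 1))) := by
    intro k
    simp_rw [M.autoCov_succ hν hg h1 h2, fun n => M.autoCov_succ hν (hgn n) (hn1 n) (hn2 n)]
    refine Tendsto.sub ?_ (hmean.mul ?_)
    · have hfst : ∀ {p : E → Prop}, (∀ᵐ x ∂M.piS, p x) →
          ∀ᵐ q ∂(M.piS ⊗ₘ (M.P ^ (k + 1))), p q.1 := by
        intro p hp
        rw [← M.map_fst_compProd_pow (k + 1)] at hp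
        exact ae_of_ae_map measurable_fst.aemeasurable hp
      have hsnd : ∀ {p : E → Prop}, (∀ᵐ x ∂M.piS, p x) →
          ∀ᵐ q ∂(M.piS ⊗ₘ (M.P ^ (k + 1))), p q.2 := by
        intro p hp
        rw [← M.map_snd_compProd_pow hν (k + 1)] at hp
        exact ae_of_ae_map measurable_snd.aemeasurable hp
      refine tendsto_integral_of_dominated_convergence (fun q => |g q.1| * B q.2) (fun n => ?_)
        (M.integrable_mul_compProd hν hg.abs hBm h2.abs hB2 _) (fun n => ?_) ?_
      · exact (((hgn n).comp measurable_fst).mul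
          ((M.measurable_center (hgn n)).comp measurable_snd)).aestronglyMeasurable
      · filter_upwards [hfst (hle n), hsnd (hcB n)] with q hq1 hq2
        rw [norm_mul, Real.norm_eq_abs, Real.norm_eq_abs]
        gcongr
      · filter_upwards [hfst hlim, hsnd hclim] with q hq1 hq2 using hq1.mul hq2
    · have hle' := M.lawAt_le_piS hν k
      exact tendsto_integral_of_dominated_convergence B
        (fun n => (M.measurable_center (hgn n)).aestronglyMeasurable)
        (hB1.mono_measure hle') (fun n => ae_mono hle' (hcB n)) (ae_mono hle' hclim)
  match l with
  | Int.ofNat 0 =>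
    change Tendsto (fun n => M.autoCov (gn n) 0) atTop (𝓝 (M.autoCov g 0))
    simp_rw [autoCov_zero]
    refine Tendsto.add ?_ ((hmean.pow 2).mul_const _)
    refine tendsto_integral_of_dominated_convergence (fun x => B x ^ 2)
      (fun n => ((M.measurable_center (hgn n)).pow_const 2).aestronglyMeasurable)
      hB2.integrable_sq (fun n => ?_) ?_
    · filter_upwards [hcB n] with x hx
      rw [norm_pow, Real.norm_eq_abs]
      gcongr
    · filter_upwards [hclim] with x hx using hx.pow 2
  | Int.ofNat (k + 1) => exact hsucc k
  | Int.negSucc k => exact hsucc k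

/-- U₀(|g|) is square integrable by `blockVar_eq` applied to |g| and dominates every |U₀(g_n)|; a
block is a finite sum, so pointwise convergence passes to it. -/
theorem tendsto_blockVar (hν : ∫⁻ x, M.escape x ∂M.ν = 0) (hg : Measurable g)
    (h1 : Integrable g M.piS) (h2 : MemLp g 2 M.piS)
    (hG : ∫⁻ x, ‖g x‖ₑ * ∫⁻ y, ‖g y‖ₑ ∂M.G x ∂M.piS ≠ ∞) (hgn : ∀ n, Measurable (gn n))
    (hle : ∀ n, ∀ᵐ x ∂M.piS, |gn n x| ≤ |g x|)
    (hlim : ∀ᵐ x ∂M.piS, Tendsto (fun n => gn n x) atTop (𝓝 (g x))) :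
    Tendsto (fun n => M.blockVar (gn n)) atTop (𝓝 (M.blockVar g)) := by
  have hL2 := (M.blockVar_eq hν hg h1 h2.integrable_sq hG).1
  have habs : MemLp (blockSum fun x => |g x|) 2 M.splitLaw := by
    refine (M.blockVar_eq hν hg.abs h1.abs ?_ ?_).1
    · simpa only [sq_abs] using h2.integrable_sq
    · simpa only [← Real.norm_eq_abs, enorm_norm] using hG
  have hbound : ∀ n, ∀ᵐ ω ∂M.splitLaw, |blockSum (gn n) ω| ≤ blockSum (fun x => |g x|) ω := by
    intro n
    filter_upwards [M.ae_splitLaw_of_ae_piS hν (hle n)] with ω hω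
    exact (Finset.abs_sum_le_sum_abs _ _).trans (Finset.sum_le_sum hω)
  have hblim : ∀ᵐ ω ∂M.splitLaw,
      Tendsto (fun n => blockSum (gn n) ω) atTop (𝓝 (blockSum g ω)) := by
    filter_upwards [M.ae_splitLaw_of_ae_piS hν hlim] with ω hω
    exact tendsto_finsetSum _ hω
  have hm := fun n => M.aestronglyMeasurable_blockSum hν (hgn n)
  have hn : ∀ n, MemLp (blockSum (gn n)) 2 M.splitLaw := fun n =>
    habs.mono (hm n) ((hbound n).mono fun ω hω => hω.trans (le_abs_self _))
  unfold blockVar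
  simp_rw [variance_eq_sub hL2, fun n => variance_eq_sub (hn n), Pi.pow_apply]
  refine Tendsto.sub ?_ (Tendsto.pow ?_ 2)
  · refine tendsto_integral_of_dominated_convergence (fun ω => blockSum (fun x => |g x|) ω ^ 2)
      (fun n => (hm n).pow 2) habs.integrable_sq (fun n => ?_) ?_
    · filter_upwards [hbound n] with ω hω
      rw [norm_pow, Real.norm_eq_abs]
      gcongr
    · filter_upwards [hblim] with ω hω using hω.pow 2
  · exact tendsto_integral_of_dominated_convergence _ hm (habs.integrable one_le_two) hbound hblim

end Approximation

end AtomicChain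

/-- Passage to the limit in bilateral sums of symmetric sequences which are, up to a dominated
term, multiples of a fixed convergent series. -/
theorem hasBilateralSum_of_tendsto {a : ℕ → ℤ → ℝ} {c : ℤ → ℝ} {V : ℕ → ℝ} {S : ℝ}
    (ha : ∀ n (k : ℕ), a n (Int.negSucc k) = a n (k + 1))
    (hc : ∀ k : ℕ, c (Int.negSucc k) = c (k + 1))
    (hlim : ∀ l, Tendsto (fun n => a n l) atTop (𝓝 (c l)))
    (hV : ∀ n, HasBilateralSum (a n) (V n)) (hVS : Tendsto V atTop (𝓝 S))
    {η : ℕ → ℝ} {ηlim : ℝ} {b : ℕ → ℝ} {d : ℕ → ℕ → ℝ}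
    (hdec : ∀ n l : ℕ, 1 ≤ l → a n (l : ℤ) = η n * b l + d n l)
    (hd : (∑' l : ℕ, ⨆ n : ℕ, ‖d n (l + 1)‖ₑ) < ∞) (hη : Tendsto η atTop (𝓝 ηlim))
    (hb : ∃ B : ℝ, Tendsto (fun N : ℕ => ∑ l ∈ Finset.Icc 1 N, b l) atTop (𝓝 B)) :
    HasBilateralSum c S ∧ (ηlim = 0 → Summable fun l : ℤ => |c l|) := by
  obtain ⟨B, hB⟩ := hb
  have hB' : Tendsto (fun N => ∑ k ∈ Finset.range N, b (k + 1)) atTop (𝓝 B) := by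
    refine hB.congr fun N => ?_
    induction N with
    | zero => simp
    | succ N ih => rw [Finset.sum_Icc_succ_top (by omega), ih, Finset.sum_range_succ]
  set D : ℕ → ℝ := fun k => (⨆ n, ‖d n (k + 1)‖ₑ).toReal with hDdef
  have hDs : Summable D := ENNReal.summable_toReal hd.ne
  have hdD : ∀ n k, ‖d n (k + 1)‖ ≤ D k := by
    intro n k
    rw [← toReal_enorm]
    exact ENNReal.toReal_mono (ENNReal.ne_top_of_tsum_ne_top hd.ne k)
      (le_iSup (fun n => ‖d n (k + 1)‖ₑ) n)
  -- The limit of `d n (k + 1)` as `n → ∞`, hence bounded by the same summable `D`.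
  set e : ℕ → ℝ := fun k => c (k + 1) - ηlim * b (k + 1) with he
  have hdec' : ∀ n (k : ℕ), a n (k + 1) = η n * b (k + 1) + d n (k + 1) := by
    intro n k
    simpa using hdec n (k + 1) (by omega)
  have hde : ∀ k, Tendsto (fun n => d n (k + 1)) atTop (𝓝 (e k)) := by
    intro k
    refine ((hlim (k + 1)).sub (hη.mul_const (b (k + 1)))).congr fun n => ?_
    rw [hdec']; ring
  have heD : ∀ k, ‖e k‖ ≤ D k := fun k => le_of_tendsto' (hde k).norm fun n => hdD n k
  have hes : Summable e := Summable.of_norm_bounded hDs heD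
  have hds : ∀ n, Summable fun k => d n (k + 1) := fun n => Summable.of_norm_bounded hDs (hdD n)
  have hn : ∀ n, HasBilateralSum (a n) (a n 0 + 2 * (η n * B + ∑' k, d n (k + 1))) := by
    intro n
    refine hasBilateralSum_of_symm (ha n) ?_
    simp_rw [hdec', Finset.sum_add_distrib, ← Finset.mul_sum]
    exact (hB'.const_mul _).add (hds n).hasSum.tendsto_sum_nat
  have hc' : HasBilateralSum c (c 0 + 2 * (ηlim * B + ∑' k, e k)) := by
    refine hasBilateralSum_of_symm hc ?_
    have h : ∀ k : ℕ, c (k + 1) = ηlim * b (k + 1) + e k := fun k => by simp only [he]; ring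
    simp_rw [h, Finset.sum_add_distrib, ← Finset.mul_sum]
    exact (hB'.const_mul _).add hes.hasSum.tendsto_sum_nat
  -- Uniqueness of the bilateral sum expresses `V n` through quantities whose limits are known.
  have hVeq : ∀ n, V n = a n 0 + 2 * (η n * B + ∑' k, d n (k + 1)) :=
    fun n => tendsto_nhds_unique (hV n) (hn n)
  have htsum : Tendsto (fun n => ∑' k, d n (k + 1)) atTop (𝓝 (∑' k, e k)) :=
    tendsto_tsum_of_dominated_convergence hDs hde (Eventually.of_forall fun n k => hdD n k)
  have hS : S = c 0 + 2 * (ηlim * B + ∑' k, e k) := by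
    refine tendsto_nhds_unique hVS ?_
    rw [funext hVeq]
    exact (hlim 0).add (((hη.mul_const B).add htsum).const_mul 2)
  refine ⟨hS ▸ hc', fun h0 => ?_⟩
  have hce : ∀ k : ℕ, c (k + 1) = e k := fun k => by simp [he, h0]
  refine Summable.of_nat_of_neg_add_one ?_ ?_
  · rw [← summable_nat_add_iff 1]
    refine hes.abs.congr fun k => ?_
    rw [← hce]; push_cast; rfl
  · refine hes.abs.congr fun k => ?_
    rw [← hce, ← hc, Int.negSucc_eq]

end

/-! ### Assembly of the two lemmas. -/

theorem lemma3p7 {E : Type*} [MeasurableSpace E] (M : AtomicChain E) (φ : Measure E)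
    (hs : IsPosFun φ M.s)
    (hirr : Kernel.IsIrreducible φ M.P)
    (haper : IsAperiodic M.P)
    (hharris : IsHarrisRecurrent φ M.P) :
    -- the small case
    (∀ g : E → ℝ, Measurable g → IsSmall φ M.P (fun x => |g x|) →
      (MemLp g 1 M.piS ∧ MemLp g 2 M.piS) ∧
      MemLp (AtomicChain.blockSum g) 2 M.splitLaw ∧
      HasBilateralSum (M.autoCov g) (M.blockVar g)) ∧
    -- the extension by approximation
    (∀ g : E → ℝ, Measurable g → MemLp g 1 M.piS → MemLp g 2 M.piS →
      (∫⁻ x, ‖g x‖ₑ * (∫⁻ y, (∫⁻ z, ‖g z‖ₑ ∂(M.G y)) ∂(M.P x)) ∂M.piS) < ∞ →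
      ∀ gn : ℕ → E → ℝ, (∀ n, Measurable (gn n)) →
        (∀ n, IsSmall φ M.P (fun x => |gn n x|)) →
        (∀ n, ∀ᵐ x ∂M.piS, |gn n x| ≤ |g x|) →
        (∀ᵐ x ∂M.piS, Tendsto (fun n => gn n x) atTop (𝓝 (g x))) →
        (∀ ℓ : ℤ, Tendsto (fun n => M.autoCov (gn n) ℓ) atTop (𝓝 (M.autoCov g ℓ))) ∧
        (MemLp (AtomicChain.blockSum g) 2 M.splitLaw ∧
          ∃ S : ℕ → ℝ, (∀ n, HasBilateralSum (M.autoCov (gn n)) (S n)) ∧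
            Tendsto S atTop (𝓝 (M.blockVar g))) ∧
        (∀ (η : ℕ → ℝ) (ηlim : ℝ) (b : ℕ → ℝ) (d : ℕ → ℕ → ℝ),
          (∀ n ℓ : ℕ, 1 ≤ ℓ → M.autoCov (gn n) (ℓ : ℤ) = η n * b ℓ + d n ℓ) →
          (∑' ℓ : ℕ, ⨆ n : ℕ, ‖d n (ℓ + 1)‖ₑ) < ∞ →
          Tendsto η atTop (𝓝 ηlim) →
          (∃ B : ℝ, Tendsto (fun N : ℕ => ∑ ℓ ∈ Finset.Icc 1 N, b ℓ) atTop (𝓝 B)) →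
          HasBilateralSum (M.autoCov g) (M.blockVar g) ∧
            (ηlim = 0 → Summable (fun ℓ : ℤ => |M.autoCov g ℓ|)))) := by
  -- Harris recurrence enters only here: it makes regeneration certain under ν.
  have hν := M.lintegral_nu_escape (M.tsum_P_pow_s_eq_top hs hharris)
  have hsmall : ∀ g : E → ℝ, Measurable g → IsSmall φ M.P (fun x => |g x|) →
      (MemLp g 1 M.piS ∧ MemLp g 2 M.piS) ∧
      MemLp (AtomicChain.blockSum g) 2 M.splitLaw ∧
      HasBilateralSum (M.autoCov g) (M.blockVar g) := by
    intro g hg hsm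
    obtain ⟨C, hC, hb⟩ := AtomicChain.IsSmall.exists_lintegral_G_le M hs hirr hsm
    have h1 := M.integrable_piS_of_lintegral_G_le hC hg hb
    refine ⟨⟨memLp_one_iff_integrable.2 h1, ?_⟩, M.hasBilateralSum_autoCov hs hirr haper hν hC hg hb⟩
    rw [memLp_two_iff_integrable_sq h1.1]
    simp_rw [sq]
    exact AtomicChain.integrable_mul_of_bounded h1 hg (M.abs_le_of_lintegral_G_le hC hg hb)
  refine ⟨hsmall, fun g hg hg1 hg2 hG gn hgn hgsm hle hlim => ?_⟩
  have h1 := memLp_one_iff_integrable.1 hg1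
  have hG' := M.lintegral_mul_G_ne_top hg hg2 hG
  have hcov := M.tendsto_autoCov hν hg h1 hg2 hgn hle hlim
  have hvar := M.tendsto_blockVar hν hg h1 hg2 hG' hgn hle hlim
  have hbil := fun n => (hsmall (gn n) (hgn n) (hgsm n)).2.2
  refine ⟨hcov, ⟨(M.blockVar_eq hν hg h1 hg2.integrable_sq hG').1, _, hbil, hvar⟩, ?_⟩
  intro η ηlim b d hdec hd hη hb
  exact hasBilateralSum_of_tendsto (fun _ _ => rfl) (fun _ => rfl) hcov hbil hvar hdec hd hη hb
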